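/- Let $n,d\ge 0$ be integers. Let $L$ be the free Lie algebra over $\mathbb{R}$ on generators $x_1,\dots,x_n$, and let $L(n,d)=L/L^{d+1}$ be the free nilpotent Lie algebra of class $d$ (where $L^{1}=L$, $L^{k+1}=[L,L^{k}]$), graded by the length of bracket monomials in the generators. A derivation $\delta$ of $L(n,d)$ is homogeneous of degree $k$ if it maps the component of degree $i$ into the component of degree $i+k$ for every $i$; let $\mathcal{D}^{(k)}$ be the space of these derivations, and let $$UL(n,d)=\bigoplus_{k=1}^{d-1}\mathcal{D}^{(k)},$$ a Lie subalgebra of the Lie algebra of all derivations of $L(n,d)$. A matrix $A\in\mathfrak{sl}_n(\mathbb{R})$ acts on $L(n,d)$ by the derivation $D_A$ with $D_A(x_j)=\sum_i A_{ij}x_i$, and on derivations by $\delta\mapsto[D_A,\delta]$. For a noncommutative polynomial $h\in\mathbb{R}\langle x_1,\dots,x_n\rangle$ let $\mathrm{AD}_h$ be the derivation of $L(n,d)$ with $\mathrm{AD}_h(x_i)=h(\operatorname{ad}x_1,\dots,\operatorname{ad}x_n)(x_i)$ for all $i$; so $\mathrm{AD}_{x_1^k}(x_i)=(\operatorname{ad}x_1)^k(x_i)$.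 **Theorem.** Suppose $d\le n(n-1)$. Then $UL(n,d)$ is generated, as a Lie algebra and $\mathfrak{sl}_n$-module, by the derivations $\mathrm{AD}_{x_1^k}$ for $1\le k<d$ together with, if $n\ge 3$, the derivation that sends $x_1$ to $[x_2,x_3]$ and all other generators to $0$. That is, $UL(n,d)$ is the smallest Lie subalgebra of the derivation algebra of $L(n,d)$ that contains these derivations and is stable under the action of $\mathfrak{sl}_n$. -/

import Mathlib

noncomputable section

namespace FreeNilpotentLie

/-- The free nilpotent Lie algebra `L(n,d)` over `ℝ` on generators `x_1, …, x_n`, of nilpotency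
class `d`: the quotient of the free Lie algebra `L` by `L^{d+1}`. In Mathlib the lower central
series is indexed so that its term number `0` is `L = L^1`; hence its term number `d` is
`L^{d+1}`. -/
abbrev FreeNil (n d : ℕ) : Type :=
  FreeLieAlgebra ℝ (Fin n) ⧸
    LieModule.lowerCentralSeries ℝ (FreeLieAlgebra ℝ (Fin n)) (FreeLieAlgebra ℝ (Fin n)) d

/-- The quotient homomorphism from the free Lie algebra to `L(n,d)`. -/
def proj (n d : ℕ) : FreeLieAlgebra ℝ (Fin n) →ₗ⁅ℝ⁆ FreeNil n d :=
  { (LieSubmodule.Quotient.mk' (LieModule.lowerCentralSeries ℝ (FreeLieAlgebra ℝ (Fin n))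
      (FreeLieAlgebra ℝ (Fin n)) d)).toLinearMap with
    map_lie' := fun {x y} => LieSubmodule.Quotient.mk_bracket _ x y }

/-- The generators of `L(n,d)`; `gen n d i` is the letter `x_{i+1}`. -/
def gen (n d : ℕ) (i : Fin n) : FreeNil n d := proj n d (FreeLieAlgebra.of ℝ i)

/-- The Lie algebra of all derivations of `L(n,d)`. -/
abbrev Der (n d : ℕ) : Type := LieDerivation ℝ (FreeNil n d) (FreeNil n d)

/-! ### Derivations with prescribed values on the generators -/

/-- The Lie algebra `L[ε]` with `ε² = 0`; a pair `(a, b)` stands for `a + ε b`. It is used only to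
construct derivations. -/
def DualLie (L : Type) : Type := L × L

namespace DualLie

variable {L : Type} [LieRing L] [LieAlgebra ℝ L]

/-- The element `a + ε b`. -/
def mk (a b : L) : DualLie L := (a, b)

instance : AddCommGroup (DualLie L) := inferInstanceAs (AddCommGroup (L × L))

instance : Module ℝ (DualLie L) := inferInstanceAs (Module ℝ (L × L))

instance : Bracket (DualLie L) (DualLie L) where
  bracket p q := (⁅p.1, q.1⁆, ⁅p.1, q.2⁆ + ⁅p.2, q.1⁆)

instance : LieRing (DualLie L) where
  add_lie p q r := by
    refine Prod.ext ?_ ?_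
    · exact add_lie p.1 q.1 r.1
    · change ⁅p.1 + q.1, r.2⁆ + ⁅p.2 + q.2, r.1⁆ =
        (⁅p.1, r.2⁆ + ⁅p.2, r.1⁆) + (⁅q.1, r.2⁆ + ⁅q.2, r.1⁆)
      rw [add_lie, add_lie]; abel
  lie_add p q r := by
    refine Prod.ext ?_ ?_
    · exact lie_add p.1 q.1 r.1
    · change ⁅p.1, q.2 + r.2⁆ + ⁅p.2, q.1 + r.1⁆ =
        (⁅p.1, q.2⁆ + ⁅p.2, q.1⁆) + (⁅p.1, r.2⁆ + ⁅p.2, r.1⁆)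
      rw [lie_add, lie_add]; abel
  lie_self p := by
    refine Prod.ext ?_ ?_
    · exact lie_self p.1
    · change ⁅p.1, p.2⁆ + ⁅p.2, p.1⁆ = 0
      rw [← lie_skew p.1 p.2]; abel
  leibniz_lie p q r := by
    refine Prod.ext ?_ ?_
    · exact leibniz_lie p.1 q.1 r.1
    · change ⁅p.1, ⁅q.1, r.2⁆ + ⁅q.2, r.1⁆⁆ + ⁅p.2, ⁅q.1, r.1⁆⁆ =
        (⁅⁅p.1, q.1⁆, r.2⁆ + ⁅⁅p.1, q.2⁆ + ⁅p.2, q.1⁆, r.1⁆) +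
        (⁅q.1, ⁅p.1, r.2⁆ + ⁅p.2, r.1⁆⁆ + ⁅q.2, ⁅p.1, r.1⁆⁆)
      simp only [lie_add, add_lie]
      rw [leibniz_lie p.1 q.1 r.2, leibniz_lie p.1 q.2 r.1, leibniz_lie p.2 q.1 r.1]; abel

instance : LieAlgebra ℝ (DualLie L) where
  lie_smul t p q := by
    refine Prod.ext ?_ ?_
    · exact lie_smul t p.1 q.1
    · change ⁅p.1, t • q.2⁆ + ⁅p.2, t • q.1⁆ = t • (⁅p.1, q.2⁆ + ⁅p.2, q.1⁆)
      rw [lie_smul, lie_smul, smul_add]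

end DualLie

variable {n d : ℕ}

/-- The homomorphism from the free Lie algebra to `L(n,d)[ε]` that sends `x_i` to `x_i + ε y_i`. -/
def dualLift (y : Fin n → FreeNil n d) : FreeLieAlgebra ℝ (Fin n) →ₗ⁅ℝ⁆ DualLie (FreeNil n d) :=
  FreeLieAlgebra.lift ℝ (fun i => DualLie.mk (gen n d i) (y i))

theorem dualLift_fst (y : Fin n → FreeNil n d) (a : FreeLieAlgebra ℝ (Fin n)) :
    (dualLift y a).1 = proj n d a := by
  let p : DualLie (FreeNil n d) →ₗ⁅ℝ⁆ FreeNil n d :=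
    { toFun := fun q => q.1
      map_add' := fun _ _ => rfl
      map_smul' := fun _ _ => rfl
      map_lie' := rfl }
  have h : p.comp (dualLift y) = proj n d := by
    apply FreeLieAlgebra.hom_ext
    intro i
    change (dualLift y (FreeLieAlgebra.of ℝ i)).1 = _
    rw [dualLift, FreeLieAlgebra.lift_of_apply]
    rfl
  exact DFunLike.congr_fun h a

/-- The `ε`-part of `dualLift`. -/
def dualSnd (y : Fin n → FreeNil n d) : FreeLieAlgebra ℝ (Fin n) →ₗ[ℝ] FreeNil n d where
  toFun a := (dualLift y a).2
  map_add' a b := by rw [map_add]; rfl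
  map_smul' t a := by rw [map_smul]; rfl

theorem dualSnd_lie (y : Fin n → FreeNil n d) (a b : FreeLieAlgebra ℝ (Fin n)) :
    dualSnd y ⁅a, b⁆ = ⁅proj n d a, dualSnd y b⁆ - ⁅proj n d b, dualSnd y a⁆ := by
  change (dualLift y ⁅a, b⁆).2 = _
  rw [LieHom.map_lie]
  change ⁅(dualLift y a).1, (dualLift y b).2⁆ + ⁅(dualLift y a).2, (dualLift y b).1⁆ = _
  rw [dualLift_fst, dualLift_fst, ← lie_skew (proj n d b)]
  change _ = ⁅_, (dualLift y b).2⁆ - -⁅(dualLift y a).2, _⁆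
  rw [sub_neg_eq_add]

theorem dualSnd_of (y : Fin n → FreeNil n d) (i : Fin n) :
    dualSnd y (FreeLieAlgebra.of ℝ i) = y i := by
  change (dualLift y (FreeLieAlgebra.of ℝ i)).2 = _
  rw [dualLift, FreeLieAlgebra.lift_of_apply]
  rfl

theorem proj_surjective (n d : ℕ) : Function.Surjective (proj n d) :=
  LieSubmodule.Quotient.surjective_mk' _

theorem proj_mem_lcs {k : ℕ} {a : FreeLieAlgebra ℝ (Fin n)}
    (ha : a ∈ LieModule.lowerCentralSeries ℝ (FreeLieAlgebra ℝ (Fin n))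
      (FreeLieAlgebra ℝ (Fin n)) k) :
    proj n d a ∈ LieModule.lowerCentralSeries ℝ (FreeNil n d) (FreeNil n d) k :=
  LieIdeal.map_lowerCentralSeries_le k (f := proj n d) (LieIdeal.mem_map ha)

theorem lcs_freeNil (n d : ℕ) :
    LieModule.lowerCentralSeries ℝ (FreeNil n d) (FreeNil n d) d = ⊥ := by
  rw [← LieIdeal.lowerCentralSeries_map_eq d (proj_surjective n d), LieIdeal.map_eq_bot_iff]
  intro a ha
  rw [LieHom.mem_ker]
  exact (LieSubmodule.Quotient.mk_eq_zero (N := LieModule.lowerCentralSeries ℝ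
    (FreeLieAlgebra ℝ (Fin n)) (FreeLieAlgebra ℝ (Fin n)) d)).2 ha

theorem dualSnd_mem_lcs (y : Fin n → FreeNil n d) (k : ℕ) :
    ∀ a ∈ LieModule.lowerCentralSeries ℝ (FreeLieAlgebra ℝ (Fin n))
      (FreeLieAlgebra ℝ (Fin n)) k,
      dualSnd y a ∈ LieModule.lowerCentralSeries ℝ (FreeNil n d) (FreeNil n d) k := by
  induction k with
  | zero => intro a _; simp
  | succ k ih =>
    intro a ha
    rw [LieModule.lowerCentralSeries_succ, ← LieSubmodule.mem_toSubmodule,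
      LieSubmodule.lieIdeal_oper_eq_linear_span'] at ha
    induction ha using Submodule.span_induction with
    | mem z hz =>
      obtain ⟨u, -, v, hv, rfl⟩ := hz
      rw [dualSnd_lie, LieModule.lowerCentralSeries_succ]
      refine sub_mem (LieSubmodule.lie_mem_lie (LieSubmodule.mem_top _) (ih v hv)) ?_
      rw [← lie_skew]
      exact neg_mem (LieSubmodule.lie_mem_lie (LieSubmodule.mem_top _) (proj_mem_lcs hv))
    | zero => rw [map_zero]; exact zero_mem _
    | add u v _ _ hu hv => rw [map_add]; exact add_mem hu hv
    | smul t u _ hu => rw [map_smul]; exact SMulMemClass.smul_mem t hu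

/-- The derivation of `L(n,d)` that sends `x_i` to `y_i` for every `i`. -/
def derOfGens (y : Fin n → FreeNil n d) : Der n d where
  toLinearMap := Submodule.liftQ _ (dualSnd y) (by
    intro a ha
    have h := dualSnd_mem_lcs y d a ha
    rw [lcs_freeNil, LieSubmodule.mem_bot] at h
    exact h)
  leibniz' := by
    intro a b
    obtain ⟨a, rfl⟩ := proj_surjective n d a
    obtain ⟨b, rfl⟩ := proj_surjective n d b
    rw [← LieHom.map_lie]
    exact dualSnd_lie y a b

theorem derOfGens_gen (y : Fin n → FreeNil n d) (i : Fin n) :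
    derOfGens y (gen n d i) = y i :=
  dualSnd_of y i

/-! ### The grading and the algebra `UL(n,d)` -/

/-- `IsMonomial k a`: the element `a` of `L(n,d)` is a bracket monomial in the generators, of
length `k`. -/
inductive IsMonomial {n d : ℕ} : ℕ → FreeNil n d → Prop
  | gen (i : Fin n) : IsMonomial 1 (gen n d i)
  | lie {p q : ℕ} {a b : FreeNil n d} (ha : IsMonomial p a) (hb : IsMonomial q b) :
      IsMonomial (p + q) ⁅a, b⁆

/-- The homogeneous component of degree `k` of `L(n,d)`. -/
def component (n d k : ℕ) : Submodule ℝ (FreeNil n d) :=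
  Submodule.span ℝ {a | IsMonomial k a}

/-- The space of homogeneous derivations of degree `k` of `L(n,d)`. -/
def derComponent (n d k : ℕ) : Submodule ℝ (Der n d) where
  carrier := {δ | ∀ i, ∀ a ∈ component n d i, δ a ∈ component n d (i + k)}
  add_mem' hδ hε i a ha := add_mem (hδ i a ha) (hε i a ha)
  zero_mem' _ _ _ := zero_mem _
  smul_mem' t _ hδ i a ha := Submodule.smul_mem _ t (hδ i a ha)

theorem lie_mem_derComponent {k l : ℕ} {δ ε : Der n d} (hδ : δ ∈ derComponent n d k)
    (hε : ε ∈ derComponent n d l) : ⁅δ, ε⁆ ∈ derComponent n d (k + l) := by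
  intro i a ha
  rw [LieDerivation.lie_apply]
  refine sub_mem ?_ ?_
  · have h := hδ _ _ (hε i a ha)
    rwa [add_assoc, add_comm l k] at h
  · have h := hε _ _ (hδ i a ha)
    rwa [add_assoc] at h

theorem lie_mem_lcs {L : Type} [LieRing L] [LieAlgebra ℝ L] (p q : ℕ) :
    ∀ a ∈ LieModule.lowerCentralSeries ℝ L L p, ∀ b ∈ LieModule.lowerCentralSeries ℝ L L q,
      ⁅a, b⁆ ∈ LieModule.lowerCentralSeries ℝ L L (p + q + 1) := by
  induction p generalizing q with
  | zero =>
    intro a _ b hb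
    rw [zero_add, LieModule.lowerCentralSeries_succ]
    exact LieSubmodule.lie_mem_lie (LieSubmodule.mem_top _) hb
  | succ p ih =>
    intro a ha b hb
    rw [LieModule.lowerCentralSeries_succ, ← LieSubmodule.mem_toSubmodule,
      LieSubmodule.lieIdeal_oper_eq_linear_span'] at ha
    induction ha using Submodule.span_induction with
    | mem z hz =>
      obtain ⟨u, -, v, hv, rfl⟩ := hz
      rw [lie_lie]
      refine sub_mem ?_ ?_
      · have h := LieSubmodule.lie_mem_lie (LieSubmodule.mem_top (R := ℝ) (L := L) u)
          (ih q v hv b hb)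
        rw [← LieModule.lowerCentralSeries_succ] at h
        rwa [show p + 1 + q + 1 = p + q + 1 + 1 by omega]
      · have hub : ⁅u, b⁆ ∈ LieModule.lowerCentralSeries ℝ L L (q + 1) := by
          rw [LieModule.lowerCentralSeries_succ]
          exact LieSubmodule.lie_mem_lie (LieSubmodule.mem_top _) hb
        have h := ih (q + 1) v hv _ hub
        rwa [show p + 1 + q + 1 = p + (q + 1) + 1 by omega]
    | zero => rw [zero_lie]; exact zero_mem _
    | add u v _ _ hu hv => rw [add_lie]; exact add_mem hu hv
    | smul t u _ hu => rw [smul_lie]; exact SMulMemClass.smul_mem t hu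

theorem IsMonomial.exists_mem_lcs {k : ℕ} {a : FreeNil n d} (h : IsMonomial k a) :
    ∃ m, k = m + 1 ∧ a ∈ LieModule.lowerCentralSeries ℝ (FreeNil n d) (FreeNil n d) m := by
  induction h with
  | gen i => exact ⟨0, rfl, by simp⟩
  | lie _ _ iha ihb =>
    obtain ⟨p, rfl, hp⟩ := iha
    obtain ⟨q, rfl, hq⟩ := ihb
    exact ⟨p + q + 1, by omega, lie_mem_lcs p q _ hp _ hq⟩

theorem component_eq_bot {k : ℕ} (hk : d < k) : component n d k = ⊥ := by
  rw [component, Submodule.span_eq_bot]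
  intro a ha
  obtain ⟨m, rfl, hm⟩ := IsMonomial.exists_mem_lcs ha
  have h := LieModule.antitone_lowerCentralSeries ℝ (FreeNil n d) (FreeNil n d)
    (Nat.lt_succ_iff.1 hk) hm
  rwa [lcs_freeNil, LieSubmodule.mem_bot] at h

theorem lieSpan_gen (n d : ℕ) : LieSubalgebra.lieSpan ℝ (FreeNil n d) (Set.range (gen n d)) = ⊤ := by
  rw [eq_top_iff]
  intro a _
  obtain ⟨a, rfl⟩ := proj_surjective n d a
  let S := LieSubalgebra.lieSpan ℝ (FreeNil n d) (Set.range (gen n d))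
  let f : FreeLieAlgebra ℝ (Fin n) →ₗ⁅ℝ⁆ S :=
    FreeLieAlgebra.lift ℝ (fun i => ⟨gen n d i, LieSubalgebra.subset_lieSpan ⟨i, rfl⟩⟩)
  have h : S.incl.comp f = proj n d := by
    apply FreeLieAlgebra.hom_ext
    intro i
    change ((f (FreeLieAlgebra.of ℝ i) : S) : FreeNil n d) = _
    rw [FreeLieAlgebra.lift_of_apply]
    rfl
  rw [← h]
  exact (f a).2

theorem der_ext {δ ε : Der n d} (h : ∀ i, δ (gen n d i) = ε (gen n d i)) : δ = ε :=
  LieDerivation.ext_of_lieSpan_eq_top (Set.range (gen n d)) (lieSpan_gen n d)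
    (by rintro _ ⟨i, rfl⟩; exact h i)

theorem derComponent_eq_bot {k : ℕ} (hk : d ≤ k) : derComponent n d k = ⊥ := by
  rw [eq_bot_iff]
  intro δ hδ
  rw [Submodule.mem_bot]
  refine der_ext fun i => ?_
  have h := hδ 1 _ (Submodule.subset_span (IsMonomial.gen i))
  rwa [component_eq_bot (by omega), Submodule.mem_bot] at h

/-- The Lie algebra `UL(n,d)`: the sum of the homogeneous components of degrees `1, …, d - 1` of
the derivation algebra of `L(n,d)`. -/
def UL (n d : ℕ) : LieSubalgebra ℝ (Der n d) where
  toSubmodule := ⨆ k ∈ Set.Ico 1 d, derComponent n d k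
  lie_mem' := by
    intro δ ε hδ hε
    change δ ∈ ⨆ k ∈ Set.Ico 1 d, derComponent n d k at hδ
    change ε ∈ ⨆ k ∈ Set.Ico 1 d, derComponent n d k at hε
    change ⁅δ, ε⁆ ∈ ⨆ k ∈ Set.Ico 1 d, derComponent n d k
    rw [iSup_subtype'] at hδ hε
    induction hδ using Submodule.iSup_induction' with
    | zero => rw [zero_lie]; exact zero_mem _
    | add u v _ _ hu hv => rw [add_lie]; exact add_mem hu hv
    | mem k u hu =>
      induction hε using Submodule.iSup_induction' with
      | zero => rw [lie_zero]; exact zero_mem _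
      | add v w _ _ hv hw => rw [lie_add]; exact add_mem hv hw
      | mem l v hv =>
        have h := lie_mem_derComponent hu hv
        by_cases hkl : k.1 + l.1 < d
        · exact Submodule.mem_iSup_of_mem (k.1 + l.1) (Submodule.mem_iSup_of_mem
            ⟨le_trans k.2.1 (Nat.le_add_right _ _), hkl⟩ h)
        · rw [derComponent_eq_bot (not_lt.1 hkl), Submodule.mem_bot] at h
          rw [h]
          exact zero_mem _

/-! ### The action of `sl_n` and the generators -/

/-- The action of a matrix `A` on `L(n,d)` by a derivation, which is the standard action on the
space spanned by the generators: `x_j ↦ ∑ i, A i j • x_i`. -/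
def matrixDer (n d : ℕ) (A : Matrix (Fin n) (Fin n) ℝ) : Der n d :=
  derOfGens fun j => ∑ i, A i j • gen n d i

/-- The smallest Lie subalgebra of the derivation algebra that contains `s` and is stable under
the action `A · δ = [A, δ]` of `sl_n`. -/
def lieSlSpan (s : Set (Der n d)) : LieSubalgebra ℝ (Der n d) :=
  sInf {K | s ⊆ K ∧
    ∀ A ∈ LieAlgebra.SpecialLinear.sl (Fin n) ℝ, ∀ δ ∈ K, ⁅matrixDer n d A, δ⁆ ∈ K}

/-- The result `h(ad x_1, …, ad x_n)` of substituting `ad x_i` for `x_i` in the noncommutative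
polynomial `h`. -/
def adSubst (n d : ℕ) : FreeAlgebra ℝ (Fin n) →ₐ[ℝ] Module.End ℝ (FreeNil n d) :=
  FreeAlgebra.lift ℝ fun i => LieAlgebra.ad ℝ (FreeNil n d) (gen n d i)

/-- The derivation `AD_h`, which sends each generator `x` to `h(ad x_1, …, ad x_n)(x)`. -/
def AD (d : ℕ) (h : FreeAlgebra ℝ (Fin n)) : Der n d :=
  derOfGens fun i => adSubst n d h (gen n d i)

/-- The derivation that sends the generator with index `i` to `f` and kills the others. -/
def derSingle (i : Fin n) (f : FreeNil n d) : Der n d :=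
  derOfGens (Pi.single i f)

end FreeNilpotentLie

end

/-! That the generators lie in `UL` is a check of degrees. For the converse, let `K` be a subalgebra
that contains them and is stable under sl_n. Degree k is spanned by the elementary derivations x_i ↦
u(ad)(x_j) with |u| = k, and induction on k shows that they lie in `K`. The index of such a
derivation at a letter o is the number of letters o in u x_j, plus one if i ≠ o. The indices at all
n letters add up to k + n, so if k < n(n-1), some index is less than n. Hence it is enough to
obtain, for every o, all derivations of index at most n - 1, and this is an induction on the index.

Index 0 comes from the generator x_1 ↦ [x_2,x_3] and from brackets of lower degrees. For index 1,
the nonzero summands of AD_{x_1^k} become equal modulo index 0, so each of them lies in `K`. In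
general, modulo index v, index v + 1 reduces to the classes of x_o ↦ h(ad)(x_o) for words h with v
letters o (`containsIndex_succ`). These letters cut h into v + 1 slots. Brackets of lower degrees
show that letters within a slot commute (`derSingle_commutator_mem`). As v + 1 ≤ n - 1, the slots
can be given distinct preferred letters other than o, and the relations from x_i ↦ x_j reduce
everything to words whose slots contain only their preferred letters (`eq_zero_of_offSlot_eq_zero`).

For v ≥ 1, bracketing with x_o ↦ [x_i,[x_i,x_o]] shortens the last slot (`eq_zero_of_last`). An
empty last slot gives [x_o,x_o] = 0. A last slot with one letter i gives a derivation of index 2 at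
i, already known if v ≥ 2; for v = 1 a small linear system settles it (`eq_zero_of_eq_one`). -/

noncomputable section
namespace FreeNilpotentLie

/-! ### Sums over the occurrences of a letter in a word -/

section Words

variable {α : Type} [DecidableEq α] {M : Type} [AddCommGroup M]

/-- The sum of `G A B` over all decompositions `u = A ++ i :: B`. -/
def splitSum (i : α) : (List α → List α → M) → List α → M
  | _, [] => 0
  | G, l :: t => (if l = i then G [] t else 0) + splitSum i (fun A B => G (l :: A) B) t

theorem splitSum_append (i : α) (G : List α → List α → M) (u v : List α) :
    splitSum i G (u ++ v) =
      splitSum i (fun A B => G A (B ++ v)) u + splitSum i (fun A B => G (u ++ A) B) v := by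
  induction u generalizing G with
  | nil => simp [splitSum]
  | cons l t ih => simp [splitSum, ih, add_assoc]

theorem splitSum_congr (i : α) {G G' : List α → List α → M} {u : List α}
    (h : ∀ A B, u = A ++ i :: B → G A B = G' A B) : splitSum i G u = splitSum i G' u := by
  induction u generalizing G G' with
  | nil => rfl
  | cons l t ih =>
    rw [splitSum, splitSum]
    congr 1
    · split_ifs with hl
      · subst hl; exact h [] t rfl
      · rfl
    · exact ih fun A B hAB => h (l :: A) B (by rw [hAB]; rfl)

theorem splitSum_const (i : α) (m : M) (u : List α) :
    splitSum i (fun _ _ => m) u = u.count i • m := by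
  induction u with
  | nil => simp [splitSum]
  | cons l t ih =>
    rw [splitSum, ih, List.count_cons]
    by_cases hl : l = i <;> simp [hl, add_smul, add_comm]

theorem splitSum_eq_smul (i : α) {G : List α → List α → M} {u : List α} {m : M}
    (h : ∀ A B, u = A ++ i :: B → G A B = m) : splitSum i G u = u.count i • m := by
  rw [splitSum_congr i h, splitSum_const]

theorem splitSum_eq_zero (i : α) {G : List α → List α → M} {u : List α}
    (h : ∀ A B, u = A ++ i :: B → G A B = 0) : splitSum i G u = 0 := by
  rw [splitSum_eq_smul i h, smul_zero]

theorem splitSum_of_notMem (i : α) (G : List α → List α → M) {u : List α} (h : i ∉ u) :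
    splitSum i G u = 0 :=
  splitSum_eq_zero i fun A B hAB => (h (by simp [hAB])).elim

theorem map_splitSum {N F : Type} [AddCommGroup N] [FunLike F M N] [AddMonoidHomClass F M N]
    (f : F) (i : α) (G : List α → List α → M) (u : List α) :
    f (splitSum i G u) = splitSum i (fun A B => f (G A B)) u := by
  induction u generalizing G with
  | nil => simp [splitSum]
  | cons l t ih =>
    simp only [splitSum, map_add, ih]
    split_ifs <;> simp

/-! ### Slots of a word

The letter `o` cuts a word into slots. The slot number `q` has a preferred letter `σ q`. -/

/-- The number of letters of a word, other than `o`, that are not the preferred letter of their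
slot; the slots are numbered from `q` on. -/
def offSlot (o : α) (σ : ℕ → α) : ℕ → List α → ℕ
  | _, [] => 0
  | q, l :: t => if l = o then offSlot o σ (q + 1) t
      else (if l = σ q then 0 else 1) + offSlot o σ q t

/-- The positions of the letter `o` in a word. -/
def slotPattern (o : α) (u : List α) : List Bool := u.map fun x => decide (x = o)

variable {o : α} {σ : ℕ → α}

@[simp] theorem slotPattern_nil : slotPattern o [] = [] := rfl

@[simp] theorem slotPattern_cons (x : α) (u : List α) :
    slotPattern o (x :: u) = decide (x = o) :: slotPattern o u := rfl

@[simp] theorem slotPattern_append (u v : List α) :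
    slotPattern o (u ++ v) = slotPattern o u ++ slotPattern o v := List.map_append ..

theorem slotPattern_length (u : List α) : (slotPattern o u).length = u.length :=
  List.length_map ..

theorem slotPattern_count (u : List α) : (slotPattern o u).count true = u.count o := by
  induction u with
  | nil => rfl
  | cons x t ih =>
    rw [slotPattern_cons, List.count_cons, List.count_cons, ih]
    by_cases h : x = o <;> simp [h]

theorem offSlot_append (q : ℕ) (u v : List α) :
    offSlot o σ q (u ++ v) = offSlot o σ q u + offSlot o σ (q + u.count o) v := by
  induction u generalizing q with
  | nil => simp [offSlot]
  | cons l t ih =>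
    by_cases hl : l = o
    · subst hl
      simp [offSlot, ih, add_comm, add_left_comm]
    · simp [offSlot, ih, hl, add_assoc]

theorem offSlot_cons_of_ne (q : ℕ) {i : α} (hi : i ≠ o) (v : List α) :
    offSlot o σ q (i :: v) = (if i = σ q then 0 else 1) + offSlot o σ q v := by
  simp [offSlot, hi]

theorem offSlot_replicate_append (q r : ℕ) (hq : σ q ≠ o) (v : List α) :
    offSlot o σ q (List.replicate r (σ q) ++ v) = offSlot o σ q v := by
  induction r with
  | zero => simp
  | succ r ih => rw [List.replicate_succ, List.cons_append, offSlot_cons_of_ne q hq, ih]; simp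

theorem exists_of_offSlot_pos {q : ℕ} {u : List α} (h : 0 < offSlot o σ q u) :
    ∃ A j B, u = A ++ j :: B ∧ j ≠ o ∧ offSlot o σ q u = offSlot o σ q (A ++ B) + 1 := by
  induction u generalizing q with
  | nil => simp [offSlot] at h
  | cons l t ih =>
    by_cases hl : l = o
    · simp only [offSlot, hl, if_true] at h ⊢
      obtain ⟨A, j, B, rfl, hj, hoff⟩ := ih h
      exact ⟨o :: A, j, B, by simp, hj, by simp [offSlot, hoff]⟩
    · by_cases hs : l = σ q
      · rw [offSlot_cons_of_ne q hl, if_pos hs, zero_add] at h ⊢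
        obtain ⟨A, j, B, rfl, hj, hoff⟩ := ih h
        refine ⟨l :: A, j, B, by simp, hj, ?_⟩
        rw [List.cons_append, offSlot_cons_of_ne q hl, if_pos hs, zero_add, hoff]
      · exact ⟨[], l, t, rfl, hl, by rw [offSlot_cons_of_ne q hl, if_neg hs]; simp [add_comm]⟩

theorem eq_of_offSlot_eq_zero {q : ℕ} {u : List α} (h : offSlot o σ q u = 0) {x : α}
    (hx : x ∈ u) (hxo : x ≠ o) : ∃ p, q ≤ p ∧ p ≤ q + u.count o ∧ x = σ p := by
  induction u generalizing q with
  | nil => simp at hx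
  | cons l t ih =>
    by_cases hl : l = o
    · subst hl
      have h' : offSlot l σ (q + 1) t = 0 := by simpa [offSlot] using h
      have hx' : x ∈ t := by simpa [hxo] using hx
      obtain ⟨p, hp1, hp2, rfl⟩ := ih h' hx'
      exact ⟨p, by omega, by simp; omega, rfl⟩
    · rw [offSlot_cons_of_ne q hl] at h
      have h1 : l = σ q := by by_contra hne; simp [hne] at h
      have h2 : offSlot o σ q t = 0 := by omega
      rcases List.mem_cons.1 hx with rfl | hx
      · exact ⟨q, le_rfl, by omega, h1⟩
      · obtain ⟨p, hp1, hp2, rfl⟩ := ih h2 hx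
        exact ⟨p, hp1, by rw [List.count_cons]; omega, rfl⟩

theorem slotPattern_append_false {C : List α} (hC : o ∉ C) (X : List Bool) :
    slotPattern o C ++ false :: X = false :: (slotPattern o C ++ X) := by
  induction C with
  | nil => rfl
  | cons x C ih =>
    simp only [List.mem_cons, not_or] at hC
    simp [ih hC.2, Ne.symm hC.1]

/-- Here `G A B` is a function of a word with a hole between `A` and `B`, and the hole may move
within its slot. Fill the hole with the preferred letter i of its slot and take the relation that
sums over all occurrences of i. Occurrences in other slots are off-slot by injectivity, so opening a
hole there lowers `offSlot`; the others give `G A B` again, once the letters i have been collected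
next to the hole. A positive multiple of `G A B` remains. -/
theorem eq_zero_of_splitSum_eq_zero [Module ℝ M] {w m : ℕ} {τ : List Bool}
    (hτ : τ.count true = w) (hσ : ∀ q ≤ w, σ q ≠ o) (hinj : ∀ p ≤ w, ∀ q ≤ w, σ p = σ q → p = q)
    {G : List α → List α → M}
    (hmove : ∀ A j B, j ≠ o → slotPattern o A ++ false :: false :: slotPattern o B = τ →
      G (A ++ [j]) B = G A (j :: B))
    (hsum : ∀ b, slotPattern o b = τ → offSlot o σ 0 b ≤ m → ∀ p ≤ w, splitSum (σ p) G b = 0)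
    {A B : List α} (hAB : slotPattern o A ++ false :: slotPattern o B = τ)
    (hm : offSlot o σ 0 (A ++ B) ≤ m) : G A B = 0 := by
  have hmoves : ∀ A C B, o ∉ C → slotPattern o A ++ false :: slotPattern o (C ++ B) = τ →
      G (A ++ C) B = G A (C ++ B) := by
    intro A C
    induction C generalizing A with
    | nil => simp
    | cons j C ih =>
      intro B hC hp
      simp only [List.mem_cons, not_or] at hC
      have hj : j ≠ o := fun h => hC.1 h.symm
      rw [show A ++ j :: C = (A ++ [j]) ++ C by simp, ih (A ++ [j]) B hC.2 (by simpa [hj] using hp),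
        hmove A j (C ++ B) hj (by simpa [hj] using hp)]
      rfl
  -- Double induction: `t` counts off-slot letters, and `c` counts the copies of the preferred
  -- letter outside the block of `r` copies already collected at the hole.
  suffices H : ∀ t c : ℕ, ∀ A B : List α, ∀ r : ℕ, offSlot o σ 0 (A ++ B) = t → t ≤ m →
      A.count (σ (A.count o)) + B.count (σ (A.count o)) = c →
      slotPattern o A ++ false :: slotPattern o (List.replicate r (σ (A.count o)) ++ B) = τ →
      G A (List.replicate r (σ (A.count o)) ++ B) = 0 from
    H _ _ A B 0 rfl hm rfl hAB
  intro t
  induction t using Nat.strong_induction_on with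
  | _ t iht =>
  intro c
  induction c using Nat.strong_induction_on with
  | _ c ihc =>
  intro A B r hoff htm hc hp
  have hAw : A.count o ≤ w := by
    rw [← hτ, ← hp, List.count_append, slotPattern_count]; omega
  set i := σ (A.count o) with hi
  have hio : i ≠ o := hσ _ hAw
  have hb : slotPattern o (A ++ (List.replicate (r + 1) i ++ B)) = τ := by
    rw [← hp]; simp [List.replicate_succ, hio]
  have hboff : offSlot o σ 0 (A ++ (List.replicate (r + 1) i ++ B)) ≤ m := by
    rw [offSlot_append, zero_add, hi, offSlot_replicate_append _ _ hio]
    rw [offSlot_append, zero_add] at hoff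
    omega
  have hs := hsum _ hb hboff _ hAw
  rw [← hi, splitSum_append, splitSum_append] at hs
  have h1 : splitSum i (fun A' B' => G A' (B' ++ (List.replicate (r + 1) i ++ B))) A = 0 := by
    refine splitSum_eq_zero i fun A1 A2 hA => ?_
    have hp' : slotPattern o A1 ++ false ::
        slotPattern o (A2 ++ (List.replicate (r + 1) i ++ B)) = τ := by
      rw [← hb, hA]; simp [hio]
    -- If an o separates this occurrence from the hole, it lies in another slot and `t` drops.
    -- Otherwise it joins the block and `c` drops.
    by_cases ho : o ∈ A2
    · have hlt : A1.count o < A.count o := by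
        rw [hA, List.count_append, List.count_cons]
        have := List.count_pos_iff.2 ho
        omega
      refine iht _ ?_ _ A1 (A2 ++ (List.replicate (r + 1) i ++ B)) 0 rfl ?_ rfl hp'
      all_goals
        have hne : i ≠ σ (A1.count o) := fun h => by
          have := hinj _ hAw _ (hlt.le.trans hAw) (hi.symm.trans h); omega
        have hcount : A1.count o + A2.count o = A.count o := by
          rw [hA, List.count_append, List.count_cons_of_ne hio]
        rw [offSlot_append, zero_add, offSlot_append, hcount, hi,
          offSlot_replicate_append _ _ hio]
        rw [hA, List.append_assoc, offSlot_append, zero_add, List.cons_append,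
          offSlot_cons_of_ne _ hio, if_neg hne, offSlot_append, hcount] at hoff
        omega
    · rw [← hmoves A1 A2 _ ho hp']
      have hA' : (A1 ++ A2).count o = A.count o := by
        rw [hA, List.count_append, List.count_append, List.count_cons_of_ne hio]
      have := ihc ((A1 ++ A2).count i + B.count i) ?_ (A1 ++ A2) B (r + 1) ?_ htm ?_ ?_
      · rwa [hA', ← hi] at this
      · rw [← hc, hA]; simp
      · rw [← hoff, hA, offSlot_append, List.append_assoc, offSlot_append, offSlot_append]
        have h0 : A2.count o = 0 := List.count_eq_zero.2 ho
        have h1 : A1.count o = A.count o := by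
          rw [hA, List.count_append, List.count_cons_of_ne hio, h0, add_zero]
        simp only [zero_add, List.count_append, h0, h1, add_zero, List.cons_append,
          offSlot_cons_of_ne _ hio, ← hi, if_true, offSlot_append]
        ring
      · rw [hA', ← hi]
      · rw [hA', ← hi, slotPattern_append, List.append_assoc, slotPattern_append_false ho,
          ← slotPattern_append, hp']
  have h2 : splitSum i (fun A' B' => G (A ++ A') (B' ++ B)) (List.replicate (r + 1) i) =
      (r + 1) • G A (List.replicate r i ++ B) := by
    rw [splitSum_eq_smul i (m := G A (List.replicate r i ++ B)), List.count_replicate_self]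
    intro A1 A2 hA
    have hA1 : ∀ x ∈ A1, x = i := fun x hx =>
      List.eq_of_mem_replicate (n := r + 1) (by rw [hA]; simp [hx])
    have hA2 : ∀ x ∈ A2, x = i := fun x hx =>
      List.eq_of_mem_replicate (n := r + 1) (by rw [hA]; simp [hx])
    have hlen : A1.length + A2.length = r := by
      have := congrArg List.length hA
      simp at this; omega
    have heq : A1 ++ (A2 ++ B) = List.replicate r i ++ B := by
      rw [List.eq_replicate_iff.2 ⟨rfl, hA1⟩, List.eq_replicate_iff.2 ⟨rfl, hA2⟩,
        ← List.append_assoc, ← List.replicate_add, hlen]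
    have ho : o ∉ A1 := fun h => hio (hA1 _ h).symm
    rw [hmoves A A1 (A2 ++ B) ho (by rw [heq]; exact hp), heq]
  have h3 : splitSum i (fun A' B' => G (A ++ (List.replicate (r + 1) i ++ A')) B') B = 0 := by
    refine splitSum_eq_zero i fun B1 B2 hB => ?_
    have hp' : slotPattern o (A ++ (List.replicate (r + 1) i ++ B1)) ++
        false :: slotPattern o B2 = τ := by
      rw [← hb, hB]; simp [hio]
    have hrep : (List.replicate (r + 1) i).count o = 0 :=
      List.count_eq_zero.2 fun h => hio (List.eq_of_mem_replicate h).symm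
    by_cases ho : o ∈ B1
    · have hpos := List.count_pos_iff.2 ho
      refine iht _ ?_ _ (A ++ (List.replicate (r + 1) i ++ B1)) B2 0 rfl ?_ rfl hp'
      all_goals
        have hle : A.count o + B1.count o ≤ w := by
          rw [← hτ, ← hb, slotPattern_count, hB]
          simp only [List.count_append]; omega
        have hne : i ≠ σ (A.count o + B1.count o) := fun h => by
          have := hinj _ hAw _ hle (by rw [← hi]; exact h); omega
        rw [List.append_assoc, List.append_assoc, offSlot_append, zero_add, hi,
          offSlot_replicate_append _ _ hio, offSlot_append]
        rw [hB, offSlot_append, zero_add, offSlot_append, offSlot_cons_of_ne _ hio,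
          if_neg hne] at hoff
        omega
    · have ho' : o ∉ List.replicate (r + 1) i ++ B1 := by
        simpa [ho, List.mem_replicate] using hio.symm
      have hp'' : slotPattern o A ++
          false :: slotPattern o (List.replicate (r + 1) i ++ (B1 ++ B2)) = τ := by
        rw [← hp', slotPattern_append, slotPattern_append A, List.append_assoc,
          slotPattern_append_false ho']
        simp
      rw [hmoves A _ B2 ho' (by rw [List.append_assoc]; exact hp''), List.append_assoc]
      refine ihc _ ?_ A (B1 ++ B2) (r + 1) ?_ htm rfl hp''
      · rw [← hc, hB]; simp only [List.count_append, List.count_cons_self, ← hi]; omega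
      · have h0 : B1.count o = 0 := List.count_eq_zero.2 ho
        rw [← hoff, hB]
        simp only [offSlot_append, zero_add, h0, add_zero, offSlot_cons_of_ne _ hio, ← hi, if_true]
  rw [h1, h2, h3, zero_add, add_zero, ← Nat.cast_smul_eq_nsmul ℝ] at hs
  exact (smul_eq_zero.1 hs).resolve_left (by positivity)

/-- A function of words vanishes on all words with a given pattern of slots if it vanishes on the
words in which every slot contains only its preferred letter, is symmetric within the slots, and
its zeros are stable under the substitution derivations. -/
theorem eq_zero_of_offSlot_eq_zero [Module ℝ M] {w : ℕ} {τ : List Bool}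
    (hτ : τ.count true = w) (hσ : ∀ q ≤ w, σ q ≠ o) (hinj : ∀ p ≤ w, ∀ q ≤ w, σ p = σ q → p = q)
    {F : List α → M}
    (hcomm : ∀ A i j B, i ≠ o → j ≠ o → slotPattern o (A ++ i :: j :: B) = τ →
      F (A ++ i :: j :: B) = F (A ++ j :: i :: B))
    (hsub : ∀ b, slotPattern o b = τ → F b = 0 → ∀ i j, i ≠ o → j ≠ o → i ≠ j →
      splitSum i (fun A B => F (A ++ j :: B)) b = 0)
    (hdiag : ∀ b, slotPattern o b = τ → offSlot o σ 0 b = 0 → F b = 0)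
    {b : List α} (hb : slotPattern o b = τ) : F b = 0 := by
  induction hm : offSlot o σ 0 b using Nat.strong_induction_on generalizing b with
  | _ m ih =>
  rcases Nat.eq_zero_or_pos m with h0 | hpos
  · exact hdiag b hb (hm.trans h0)
  obtain ⟨A, j, B, rfl, hj, hoff⟩ := exists_of_offSlot_pos (hm ▸ hpos)
  -- The hole is the place of one off-slot letter `j`. Words with at most `m - 1` off-slot letters
  -- are zeros of `F` by induction, and replacing i by `j` in them gives the required relations.
  refine eq_zero_of_splitSum_eq_zero (G := fun A B => F (A ++ j :: B)) (m := m - 1) hτ hσ hinj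
    ?_ ?_ (A := A) (B := B) (by simpa [hj] using hb) (by omega)
  · intro A l B hl hp
    simpa using hcomm A l j B hl hj (by simpa [hl, hj] using hp)
  · intro b hb hbm p hp
    have hF : F b = 0 := ih _ (by omega) hb rfl
    by_cases hpj : σ p = j
    · rw [splitSum_eq_smul (σ p) (m := F b) fun X Y hXY => by rw [hXY, hpj], hF, smul_zero]
    · exact hsub b hb hF _ _ (hσ p hp) hj hpj

end Words

variable {n d : ℕ}

/-! ### Additivity of the bracket, in terms of the bracket of a Lie ring -/

section Bracket

variable {L : Type} [LieRing L]

theorem bracket_zero (a : L) : LieRing.toBracket.bracket a 0 = 0 := lie_zero a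

theorem bracket_add (a b c : L) : LieRing.toBracket.bracket a (b + c) =
    LieRing.toBracket.bracket a b + LieRing.toBracket.bracket a c := lie_add a b c

theorem bracket_smul [LieAlgebra ℝ L] (t : ℝ) (a b : L) : LieRing.toBracket.bracket a (t • b) =
    t • LieRing.toBracket.bracket a b := lie_smul t a b

theorem bracket_bracket (a b c : L) :
    LieRing.toBracket.bracket (LieRing.toBracket.bracket a b) c =
      LieRing.toBracket.bracket a (LieRing.toBracket.bracket b c) -
        LieRing.toBracket.bracket b (LieRing.toBracket.bracket a c) := lie_lie a b c

theorem bracket_self (a : L) : LieRing.toBracket.bracket a a = 0 := lie_self a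

theorem bracket_skew (a b : L) : LieRing.toBracket.bracket a b =
    -LieRing.toBracket.bracket b a := (lie_skew a b).symm

end Bracket

/-! ### Right-normed brackets and elementary derivations -/

/-- The operator `ad x_{u_1} ∘ ⋯ ∘ ad x_{u_m}` of a word `u`. -/
def adWord (u : List (Fin n)) : Module.End ℝ (FreeNil n d) :=
  (u.map fun i => (LieAlgebra.ad ℝ (FreeNil n d) (gen n d i) : Module.End ℝ (FreeNil n d))).prod

@[simp] theorem adWord_nil (z : FreeNil n d) : adWord [] z = z := rfl

@[simp] theorem adWord_cons (i : Fin n) (u : List (Fin n)) (z : FreeNil n d) :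
    adWord (i :: u) z = ⁅gen n d i, adWord u z⁆ := rfl

theorem adWord_append (u v : List (Fin n)) (z : FreeNil n d) :
    adWord (u ++ v) z = adWord u (adWord v z) := by
  simp [adWord, Module.End.mul_apply]

theorem adSubst_pow (i : Fin n) (k : ℕ) :
    adSubst n d (FreeAlgebra.ι ℝ i ^ k) = adWord (List.replicate k i) := by
  simp [adSubst, adWord]

theorem derSingle_gen_self (i : Fin n) (f : FreeNil n d) : derSingle i f (gen n d i) = f := by
  simp [derSingle, derOfGens_gen]

theorem derSingle_gen_of_ne {i j : Fin n} (h : j ≠ i) (f : FreeNil n d) :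
    derSingle i f (gen n d j) = 0 := by
  simp [derSingle, derOfGens_gen, h]

/-- The derivation `derSingle i f`, as a linear function of `f`. -/
def derSingleLin (i : Fin n) : FreeNil n d →ₗ[ℝ] Der n d where
  toFun := derSingle i
  map_add' f g := der_ext fun j => by
    rcases eq_or_ne j i with rfl | h
    · simp [derSingle_gen_self]
    · simp [derSingle_gen_of_ne h]
  map_smul' t f := der_ext fun j => by
    rcases eq_or_ne j i with rfl | h
    · simp [derSingle_gen_self]
    · simp [derSingle_gen_of_ne h]

theorem derSingleLin_apply (i : Fin n) (f : FreeNil n d) : derSingleLin i f = derSingle i f := rfl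

theorem derSingle_zero (i : Fin n) : derSingle i (0 : FreeNil n d) = 0 := map_zero (derSingleLin i)

theorem derSingle_add (i : Fin n) (f g : FreeNil n d) :
    derSingle i (f + g) = derSingle i f + derSingle i g := map_add (derSingleLin i) f g

theorem derSingle_sub (i : Fin n) (f g : FreeNil n d) :
    derSingle i (f - g) = derSingle i f - derSingle i g := map_sub (derSingleLin i) f g

theorem derSingle_neg (i : Fin n) (f : FreeNil n d) :
    derSingle i (-f) = -derSingle i f := map_neg (derSingleLin i) f

theorem derivation_lie (D : Der n d) (a b : FreeNil n d) : D ⁅a, b⁆ = ⁅D a, b⁆ + ⁅a, D b⁆ := by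
  rw [LieDerivation.apply_lie_eq_add, add_comm]

/-- Both sides are derivations, so comparing them on generators suffices. Often one of the two terms
vanishes, because the value of one derivation does not involve the letter moved by the other. -/
theorem lie_derSingle_derSingle (i j : Fin n) (f g : FreeNil n d) :
    ⁅derSingle i f, derSingle j g⁆ =
      derSingle j (derSingle i f g) - derSingle i (derSingle j g f) := by
  refine der_ext fun l => ?_
  rw [LieDerivation.lie_apply, LieDerivation.sub_apply]
  rcases eq_or_ne l i with rfl | hi <;> rcases eq_or_ne l j with rfl | hj <;>
    simp [derSingle_gen_self, derSingle_gen_of_ne, *]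

/-- Leibniz rule along a right-normed bracket. It turns brackets of derivations into sums over
occurrences of a letter. -/
theorem derSingle_adWord (i : Fin n) (f : FreeNil n d) (u : List (Fin n)) (z : FreeNil n d) :
    derSingle i f (adWord u z) = adWord u (derSingle i f z) +
      splitSum i (fun A B => adWord A ⁅f, adWord B z⁆) u := by
  induction u with
  | nil => simp [splitSum]
  | cons l t ih =>
    rw [adWord_cons, derivation_lie, ih, bracket_add, splitSum]
    rw [show splitSum i (fun A B => adWord (l :: A) ⁅f, adWord B z⁆) t =
      ⁅gen n d l, splitSum i (fun A B => adWord A ⁅f, adWord B z⁆) t⁆ from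
        (map_splitSum (LieAlgebra.ad ℝ (FreeNil n d) (gen n d l)) i _ t).symm]
    rcases eq_or_ne l i with rfl | h
    · simp [derSingle_gen_self]; abel
    · simp [derSingle_gen_of_ne h, h]

theorem derSingle_adWord_of_notMem {i : Fin n} (f : FreeNil n d) {u : List (Fin n)} (hu : i ∉ u)
    (z : FreeNil n d) : derSingle i f (adWord u z) = adWord u (derSingle i f z) := by
  rw [derSingle_adWord, splitSum_of_notMem i _ hu, add_zero]

theorem derSingle_adWord_gen_of_notMem {i j : Fin n} (f : FreeNil n d) {u : List (Fin n)}
    (hu : i ∉ u) (hj : j ≠ i) : derSingle i f (adWord u (gen n d j)) = 0 := by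
  rw [derSingle_adWord_of_notMem f hu, derSingle_gen_of_ne hj, map_zero]

theorem derSingle_adWord_gen_of_ne {i j : Fin n} (f : FreeNil n d) (u : List (Fin n))
    (hj : j ≠ i) : derSingle i f (adWord u (gen n d j)) =
      splitSum i (fun A B => adWord A ⁅f, adWord B (gen n d j)⁆) u := by
  rw [derSingle_adWord, derSingle_gen_of_ne hj, map_zero, zero_add]

theorem derivation_eq_sum (δ : Der n d) : δ = ∑ i, derSingle i (δ (gen n d i)) := by
  refine der_ext fun j => ?_
  have : ∀ s : Finset (Fin n), (∑ i ∈ s, derSingle i (δ (gen n d i))) (gen n d j) =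
      ∑ i ∈ s, derSingle i (δ (gen n d i)) (gen n d j) := by
    intro s
    induction s using Finset.induction_on with
    | empty => simp
    | insert a s ha ih => rw [Finset.sum_insert ha, Finset.sum_insert ha, LieDerivation.add_apply, ih]
  rw [this, Finset.sum_eq_single j]
  · rw [derSingle_gen_self]
  · intro b _ hb
    exact derSingle_gen_of_ne hb.symm _
  · simp

/-! ### Right-normed brackets span the homogeneous components -/

/-- The span of `adWord w z` for the rearrangements `w` of a word `u`. -/
def permSpan (u : List (Fin n)) (z : FreeNil n d) : Submodule ℝ (FreeNil n d) :=
  Submodule.span ℝ {y | ∃ w : List (Fin n), w.Perm u ∧ y = adWord w z}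

/-- The Jacobi identity expands ad of a right-normed bracket into products of the ad x_i. Only
rearrangements occur, so letter counts are preserved, which the index argument needs. -/
theorem lie_adWord_gen_mem_permSpan (u : List (Fin n)) (j : Fin n) (z : FreeNil n d) :
    ⁅adWord u (gen n d j), z⁆ ∈ permSpan (u ++ [j]) z := by
  induction u generalizing z with
  | nil => exact Submodule.subset_span ⟨[j], .rfl, rfl⟩
  | cons i u ih =>
    rw [adWord_cons, bracket_bracket]
    refine sub_mem ?_ ?_
    · have h := ih z
      rw [permSpan] at h
      generalize ⁅adWord u (gen n d j), z⁆ = y at h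
      induction h using Submodule.span_induction with
      | mem y hy =>
        obtain ⟨w, hw, rfl⟩ := hy
        exact Submodule.subset_span ⟨i :: w, hw.cons i, rfl⟩
      | zero => rw [bracket_zero]; exact zero_mem _
      | add a b _ _ ha hb => rw [bracket_add]; exact add_mem ha hb
      | smul t a _ ha => rw [bracket_smul]; exact Submodule.smul_mem _ t ha
    · refine Submodule.span_le.2 ?_ (ih ⁅gen n d i, z⁆)
      rintro _ ⟨w, hw, rfl⟩
      refine Submodule.subset_span ⟨w ++ [i], ?_, by rw [adWord_append]; rfl⟩
      exact (List.perm_append_comm).trans (hw.cons i)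

theorem lie_adWord_mem_span (p q : ℕ) (u v : List (Fin n)) (i j : Fin n) (hu : u.length + 1 = p)
    (hv : v.length + 1 = q) : ⁅adWord u (gen n d i), adWord v (gen n d j)⁆ ∈
      Submodule.span ℝ {y : FreeNil n d | ∃ (w : List (Fin n)) (l : Fin n), w.length + 1 = p + q ∧
        y = adWord w (gen n d l)} := by
  refine Submodule.span_mono ?_ (lie_adWord_gen_mem_permSpan u i _)
  rintro _ ⟨w, hw, rfl⟩
  have := hw.length_eq
  exact ⟨w ++ v, j, by simp at this ⊢; omega, by rw [adWord_append]⟩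

theorem component_le_span (k : ℕ) : component n d k ≤
    Submodule.span ℝ {y : FreeNil n d | ∃ (w : List (Fin n)) (l : Fin n), w.length + 1 = k ∧
        y = adWord w (gen n d l)} := by
  refine Submodule.span_le.2 fun a ha => ?_
  change IsMonomial k a at ha
  induction ha with
  | gen i => exact Submodule.subset_span ⟨[], i, rfl, rfl⟩
  | @lie p q a b hma hmb iha ihb =>
    rw [SetLike.mem_coe] at iha ihb ⊢
    clear hma hmb
    induction iha using Submodule.span_induction with
    | zero => rw [zero_lie]; exact zero_mem _
    | add a b _ _ ha hb => rw [add_lie]; exact add_mem ha hb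
    | smul t a _ ha => rw [smul_lie]; exact Submodule.smul_mem _ t ha
    | mem a ha =>
      induction ihb using Submodule.span_induction with
      | zero => rw [bracket_zero]; exact zero_mem _
      | add a b _ _ ha hb => rw [bracket_add]; exact add_mem ha hb
      | smul t a _ ha => rw [bracket_smul]; exact Submodule.smul_mem _ t ha
      | mem b hb =>
        obtain ⟨u, i, hu, rfl⟩ := ha
        obtain ⟨v, j, hv, rfl⟩ := hb
        exact lie_adWord_mem_span p q u v i j hu hv

theorem isMonomial_adWord (u : List (Fin n)) (j : Fin n) :
    IsMonomial (u.length + 1) (adWord u (gen n d j)) := by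
  induction u with
  | nil => exact .gen j
  | cons i u ih =>
    have := IsMonomial.lie (.gen i) ih
    rwa [add_comm 1] at this

/-! ### Degrees of derivations and stability under sl_n -/

theorem derOfGens_mem_derComponent {k : ℕ} {y : Fin n → FreeNil n d}
    (hy : ∀ i, y i ∈ component n d (k + 1)) : derOfGens y ∈ derComponent n d k := by
  intro i a ha
  have hlie : ∀ p q : ℕ, ∀ a ∈ component n d p, ∀ b ∈ component n d q,
      ⁅a, b⁆ ∈ component n d (p + q) := by
    intro p q a ha b hb
    induction ha using Submodule.span_induction with
    | zero => rw [zero_lie]; exact zero_mem _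
    | add a b _ _ ha hb => rw [add_lie]; exact add_mem ha hb
    | smul t a _ ha => rw [smul_lie]; exact Submodule.smul_mem _ t ha
    | mem a ha =>
      induction hb using Submodule.span_induction with
      | zero => rw [bracket_zero]; exact zero_mem _
      | add a b _ _ ha hb => rw [bracket_add]; exact add_mem ha hb
      | smul t a _ ha => rw [bracket_smul]; exact Submodule.smul_mem _ t ha
      | mem b hb => exact Submodule.subset_span (IsMonomial.lie ha hb)
  induction ha using Submodule.span_induction with
  | zero => rw [map_zero]; exact zero_mem _
  | add a b _ _ ha hb => rw [map_add]; exact add_mem ha hb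
  | smul t a _ ha => rw [map_smul]; exact Submodule.smul_mem _ t ha
  | mem a ha =>
    change IsMonomial i a at ha
    induction ha with
    | gen i => rw [derOfGens_gen, add_comm]; exact hy i
    | @lie p q a b ha hb iha ihb =>
      rw [derivation_lie]
      refine add_mem ?_ ?_
      · have := hlie _ _ _ iha b (Submodule.subset_span hb)
        rwa [show p + k + q = p + q + k by ring] at this
      · have := hlie _ _ a (Submodule.subset_span ha) _ ihb
        rwa [← add_assoc] at this

theorem matrixDer_single (i j : Fin n) :
    matrixDer n d (Matrix.single i j 1) = derSingle j (gen n d i) := by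
  refine der_ext fun l => ?_
  rw [matrixDer, derOfGens_gen]
  rcases eq_or_ne l j with rfl | h
  · rw [derSingle_gen_self, Finset.sum_eq_single i]
    · simp
    · intro b _ hb; simp [hb.symm]
    · simp
  · rw [derSingle_gen_of_ne h]
    exact Finset.sum_eq_zero fun b _ => by simp [h.symm]

theorem lie_derSingle_mem_of_sl_stable {K : LieSubalgebra ℝ (Der n d)}
    (hK : ∀ A ∈ LieAlgebra.SpecialLinear.sl (Fin n) ℝ, ∀ δ ∈ K, ⁅matrixDer n d A, δ⁆ ∈ K)
    {i j : Fin n} (hij : i ≠ j) {δ : Der n d} (hδ : δ ∈ K) :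
    ⁅derSingle i (gen n d j), δ⁆ ∈ K := by
  rw [← matrixDer_single]
  refine hK _ ?_ δ hδ
  change Matrix.single j i (1 : ℝ) ∈ (Matrix.traceLinearMap (Fin n) ℝ ℝ).ker
  rw [LinearMap.mem_ker]
  exact Matrix.trace_single_eq_of_ne _ _ _ hij.symm

theorem UL_sl_stable (A : Matrix (Fin n) (Fin n) ℝ) {δ : Der n d} (hδ : δ ∈ UL n d) :
    ⁅matrixDer n d A, δ⁆ ∈ UL n d := by
  change δ ∈ ⨆ k ∈ Set.Ico 1 d, derComponent n d k at hδ
  change _ ∈ ⨆ k ∈ Set.Ico 1 d, derComponent n d k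
  have hA : matrixDer n d A ∈ derComponent n d 0 :=
    derOfGens_mem_derComponent fun i => Submodule.sum_mem _ fun j _ =>
      Submodule.smul_mem _ _ (Submodule.subset_span (.gen j))
  rw [iSup_subtype'] at hδ
  induction hδ using Submodule.iSup_induction' with
  | zero => rw [lie_zero]; exact zero_mem _
  | add u v _ _ hu hv => rw [lie_add]; exact add_mem hu hv
  | mem k u hu =>
    have h := lie_mem_derComponent hA hu
    rw [zero_add] at h
    exact Submodule.mem_iSup_of_mem k.1 (Submodule.mem_iSup_of_mem k.2 h)

theorem derComponent_le_UL {k : ℕ} (hk : 1 ≤ k) {δ : Der n d} (hδ : δ ∈ derComponent n d k) :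
    δ ∈ UL n d := by
  change δ ∈ ⨆ k ∈ Set.Ico 1 d, derComponent n d k
  by_cases hkd : k < d
  · exact Submodule.mem_iSup_of_mem k (Submodule.mem_iSup_of_mem ⟨hk, hkd⟩ hδ)
  · rw [derComponent_eq_bot (not_lt.1 hkd), Submodule.mem_bot] at hδ
    rw [hδ]; exact zero_mem _

theorem UL_le_of_derSingle_mem {K : LieSubalgebra ℝ (Der n d)}
    (h : ∀ u : List (Fin n), 1 ≤ u.length → u.length < d → ∀ i j,
      derSingle i (adWord u (gen n d j)) ∈ K) : UL n d ≤ K := by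
  change (⨆ k ∈ Set.Ico 1 d, derComponent n d k) ≤ K.toSubmodule
  refine iSup₂_le fun k hk δ hδ => ?_
  rw [derivation_eq_sum δ]
  refine Submodule.sum_mem _ fun i _ => ?_
  have hi := hδ 1 _ (Submodule.subset_span (.gen i))
  rw [add_comm] at hi
  have hle : Submodule.span ℝ {y : FreeNil n d | ∃ (w : List (Fin n)) (l : Fin n),
      w.length + 1 = k + 1 ∧ y = adWord w (gen n d l)} ≤
      K.toSubmodule.comap (derSingleLin i) := by
    refine Submodule.span_le.2 ?_
    rintro _ ⟨w, l, hw, rfl⟩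
    have hw : w.length = k := by omega
    exact h w (hw ▸ hk.1) (hw ▸ hk.2) i l
  exact hle (component_le_span _ hi)

/-! ### Subalgebras stable under substitutions -/

/-- The subalgebra `K` is stable under the substitution derivations `x_i ↦ x_j`, `i ≠ j`. -/
def SubstStable (K : LieSubalgebra ℝ (Der n d)) : Prop :=
  ∀ i j, i ≠ j → ∀ δ ∈ K, ⁅derSingle i (gen n d j), δ⁆ ∈ K

/-- The subalgebra `K` contains all homogeneous derivations of degree `k`. -/
def ContainsDegree (K : LieSubalgebra ℝ (Der n d)) (k : ℕ) : Prop :=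
  ∀ (i j : Fin n) (u : List (Fin n)), u.length = k → derSingle i (adWord u (gen n d j)) ∈ K

/-- The subalgebra `K` contains the derivations of degree `k` whose weight with respect to the
letter `o` is `v - 1`. -/
def ContainsIndex (K : LieSubalgebra ℝ (Der n d)) (k v : ℕ) (o : Fin n) : Prop :=
  ∀ (i j : Fin n) (u : List (Fin n)), u.length = k →
    (u ++ [j]).count o + (if i = o then 0 else 1) = v → derSingle i (adWord u (gen n d j)) ∈ K

/-- The class of a derivation modulo `K`. -/
def modClass (K : LieSubalgebra ℝ (Der n d)) : Der n d →ₗ[ℝ] Der n d ⧸ K.toSubmodule :=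
  K.toSubmodule.mkQ

/-- The class modulo `K` of the derivation that sends `x_o` to `u(ad x_1, …, ad x_n)(x_o)` and
kills the other generators. -/
def wordClass (K : LieSubalgebra ℝ (Der n d)) (o : Fin n) (u : List (Fin n)) :
    Der n d ⧸ K.toSubmodule :=
  modClass K (derSingle o (adWord u (gen n d o)))

variable {K : LieSubalgebra ℝ (Der n d)}

theorem modClass_eq_zero {δ : Der n d} : modClass K δ = 0 ↔ δ ∈ K :=
  Submodule.Quotient.mk_eq_zero _

theorem wordClass_eq_zero {o : Fin n} {u : List (Fin n)} :
    wordClass K o u = 0 ↔ derSingle o (adWord u (gen n d o)) ∈ K := modClass_eq_zero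

theorem modClass_derSingle_splitSum (o i : Fin n)
    (G : List (Fin n) → List (Fin n) → FreeNil n d) (u : List (Fin n)) :
    modClass K (derSingle o (splitSum i G u)) =
      splitSum i (fun A B => modClass K (derSingle o (G A B))) u :=
  map_splitSum ((modClass K).comp (derSingleLin o)) i G u

theorem splitSum_modClass_eq_zero {i o : Fin n} (hi : i ≠ o) {f : FreeNil n d}
    {b : List (Fin n)} (h : ⁅derSingle i f, derSingle o (adWord b (gen n d o))⁆ ∈ K)
    (hf : derSingle o (adWord b (gen n d o)) f = 0) :
    splitSum i (fun A B => modClass K (derSingle o (adWord A ⁅f, adWord B (gen n d o)⁆))) b = 0 := by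
  rw [lie_derSingle_derSingle, hf, derSingle_zero, sub_zero,
    derSingle_adWord_gen_of_ne _ _ hi.symm] at h
  rw [← modClass_derSingle_splitSum]
  exact modClass_eq_zero.2 h

theorem splitSum_wordClass_eq_zero (hK : SubstStable K) {i j o : Fin n} (hi : i ≠ o) (hj : j ≠ o)
    (hij : i ≠ j) {b : List (Fin n)} (hb : wordClass K o b = 0) :
    splitSum i (fun A B => wordClass K o (A ++ j :: B)) b = 0 := by
  have := splitSum_modClass_eq_zero hi (hK i j hij _ (wordClass_eq_zero.1 hb))
    (derSingle_gen_of_ne hj _)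
  rw [← this]
  exact splitSum_congr i fun A B _ => by rw [wordClass, adWord_append, adWord_cons]

theorem splitSum_mem {M : Type} [AddCommGroup M] [Module ℝ M] (S : Submodule ℝ M) {i : Fin n}
    {G : List (Fin n) → List (Fin n) → M} {u : List (Fin n)}
    (h : ∀ A B, u = A ++ i :: B → G A B ∈ S) : splitSum i G u ∈ S := by
  rw [← Submodule.Quotient.mk_eq_zero, ← Submodule.mkQ_apply, map_splitSum]
  exact splitSum_eq_zero i fun A B hAB => (Submodule.Quotient.mk_eq_zero _).2 (h A B hAB)

theorem derSingle_mem_of_mem_span {i : Fin n} {s : Set (FreeNil n d)} {f : FreeNil n d}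
    (hf : f ∈ Submodule.span ℝ s) (h : ∀ g ∈ s, derSingle i g ∈ K) : derSingle i f ∈ K := by
  have hle : Submodule.span ℝ s ≤ K.toSubmodule.comap (derSingleLin i) := Submodule.span_le.2 h
  exact hle hf

/-- Write [x_o, z] as -[z, x_o] at an occurrence of o and expand ad z: this brings x_o to the
innermost place. -/
theorem adWord_gen_mem_span_of_mem {o j : Fin n} {u : List (Fin n)} (ho : o ∈ u ++ [j]) :
    adWord u (gen n d j) ∈ Submodule.span ℝ {y | ∃ h : List (Fin n), h.length = u.length ∧
      h.count o + 1 = (u ++ [j]).count o ∧ y = adWord h (gen n d o)} := by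
  rcases eq_or_ne j o with rfl | hj
  · exact Submodule.subset_span ⟨u, rfl, by simp, rfl⟩
  · have hou : o ∈ u := by simpa [hj.symm] using ho
    obtain ⟨A, B, rfl⟩ := List.append_of_mem hou
    rw [adWord_append, adWord_cons, bracket_skew, map_neg]
    refine neg_mem ?_
    have h := Submodule.mem_map_of_mem (f := (adWord A : Module.End ℝ (FreeNil n d)))
      (lie_adWord_gen_mem_permSpan B j (gen n d o))
    rw [permSpan, Submodule.map_span] at h
    refine Submodule.span_mono ?_ h
    rintro _ ⟨_, ⟨w, hw, rfl⟩, rfl⟩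
    refine ⟨A ++ w, ?_, ?_, (adWord_append A w _).symm⟩
    · have := hw.length_eq
      simp at this ⊢; omega
    · have := hw.count_eq o
      simp [hj] at this ⊢; omega

/-- The bracket of x_i ↦ x_o with x_o ↦ f, which has index v, is the difference of the two
derivations. So, modulo index v, the moved generator can be changed to x_o. -/
theorem modClass_derSingle_eq (hK : SubstStable K) {k v : ℕ} {o i j : Fin n} {u : List (Fin n)}
    (hv : ContainsIndex K k v o) (hi : i ≠ o) (hu : u.length = k) (hc : (u ++ [j]).count o = v) :
    modClass K (derSingle i (adWord u (gen n d j))) =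
      modClass K (derSingle o (derSingle i (gen n d o) (adWord u (gen n d j)))) := by
  have h := hK i o hi _ (hv o j u hu (by simp [← hc]))
  rw [lie_derSingle_derSingle, derSingle_gen_self, ← modClass_eq_zero, map_sub] at h
  exact (sub_eq_zero.1 h).symm

/-- Make x_o the moved generator by `modClass_derSingle_eq`, then bring an x_o to the innermost
place; the remaining word has `v` letters `o`. -/
theorem containsIndex_succ (hK : SubstStable K) {k v : ℕ} {o : Fin n}
    (hv : ContainsIndex K k v o)
    (hcore : ∀ h : List (Fin n), h.length = k → h.count o = v → wordClass K o h = 0) :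
    ContainsIndex K k (v + 1) o := by
  have key : ∀ (j : Fin n) (u : List (Fin n)), u.length = k → (u ++ [j]).count o = v + 1 →
      derSingle o (adWord u (gen n d j)) ∈ K := by
    intro j u hu hc
    refine derSingle_mem_of_mem_span (adWord_gen_mem_span_of_mem (o := o)
      (List.count_pos_iff.1 (by omega))) ?_
    rintro _ ⟨h, hl, hh, rfl⟩
    exact wordClass_eq_zero.1 (hcore h (hl.trans hu) (by omega))
  intro i j u hu hc
  rcases eq_or_ne i o with rfl | hi
  · exact key j u hu (by simpa using hc)
  · rw [if_neg hi] at hc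
    rw [← modClass_eq_zero, modClass_derSingle_eq hK hv hi hu (by omega), modClass_eq_zero,
      derSingle_adWord, derSingle_add]
    refine add_mem ?_ ?_
    · rcases eq_or_ne j i with rfl | hji
      · rw [derSingle_gen_self]
        exact key o u hu (by simp [hi] at hc ⊢; omega)
      · rw [derSingle_gen_of_ne hji, map_zero, derSingle_zero]
        exact zero_mem _
    · rw [← derSingleLin_apply, map_splitSum]
      refine splitSum_mem K.toSubmodule fun A B hAB => ?_
      rw [derSingleLin_apply, ← adWord_cons, ← adWord_append]
      subst hAB
      refine key j _ (by simpa using hu) ?_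
      simp only [List.append_assoc, List.count_append, List.cons_append, List.count_cons_self,
        List.count_cons_of_ne hi] at hc ⊢
      omega

/-! ### Commutation of the letters in a slot -/

/-- Descending induction on the length of `c`, with ⁅c x_j, ·⁆ placed in a hole. Moving the hole
past a letter l costs the same expression for `l :: c`, which is longer. Summing over the
occurrences of a letter i gives the bracket of x_i ↦ c x_j with some x_o ↦ b x_o, both of lower
degree. -/
theorem derSingle_commutator_mem {k w : ℕ} {o : Fin n} {σ : ℕ → Fin n}
    (hlow : ∀ l, 1 ≤ l → l < k → ContainsDegree K l)
    (hσ : ∀ q ≤ w, σ q ≠ o) (hinj : ∀ p ≤ w, ∀ q ≤ w, σ p = σ q → p = q)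
    (c : List (Fin n)) (j : Fin n) (A B : List (Fin n)) (hc : o ∉ c) (hj : j ≠ o)
    (hc1 : 1 ≤ c.length) (hk : A.length + B.length + c.length + 1 = k)
    (hw : A.count o + B.count o = w) :
    derSingle o (adWord A ⁅adWord c (gen n d j), adWord B (gen n d o)⁆) ∈ K := by
  induction hm : k - c.length using Nat.strong_induction_on generalizing c A B with
  | _ m ih =>
  rw [← modClass_eq_zero]
  have hlen : ∀ A' B', slotPattern o A' ++ false :: slotPattern o B' =
      slotPattern o A ++ false :: slotPattern o B →
      A'.length + B'.length = A.length + B.length ∧ A'.count o + B'.count o = w := by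
    intro A' B' h
    have h1 := congrArg List.length h
    have h2 := congrArg (List.count true) h
    simp [slotPattern_length, slotPattern_count] at h1 h2
    omega
  refine eq_zero_of_splitSum_eq_zero (w := w) (o := o) (σ := σ)
    (τ := slotPattern o A ++ false :: slotPattern o B)
    (G := fun A B => modClass K
      (derSingle o (adWord A ⁅adWord c (gen n d j), adWord B (gen n d o)⁆)))
    -- The relations hold for all words of this pattern, so any sufficiently large bound `m` will
    -- do.
    (m := offSlot o σ 0 (A ++ B) + k) ?_ hσ hinj ?_ ?_ rfl (by omega)
  · simp [slotPattern_count, hw]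
  · intro A' l B' hl hp
    obtain ⟨h1, h2⟩ := hlen A' (l :: B') (by simpa [hl] using hp)
    simp only [List.length_cons, List.count_cons_of_ne hl] at h1 h2
    have h := ih (k - (l :: c).length) (by simp; omega) (l :: c) A' B' (by simp [hc, hl.symm])
      (by simp) (by simp; omega) h2 rfl
    rw [adWord_cons, bracket_bracket, map_sub, derSingle_sub, ← modClass_eq_zero, map_sub,
      sub_eq_zero] at h
    simpa [adWord_append] using h
  · intro b hb _ p hp
    have hbl : b.length = A.length + B.length + 1 := by
      rw [← slotPattern_length (o := o), hb]; simp [slotPattern_length]; omega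
    refine splitSum_modClass_eq_zero (hσ p hp) (K.lie_mem ?_ ?_)
      (derSingle_adWord_gen_of_notMem _ hc hj)
    · exact hlow c.length hc1 (by omega) _ _ _ rfl
    · exact hlow b.length (by omega) (by omega) _ _ _ rfl

/-- The hypotheses under which the classes of words of length `k` with `w` letters `o` are
studied: lower degrees are contained in `K`, and there is a preferred letter for every slot. -/
structure SlotSetup (K : LieSubalgebra ℝ (Der n d)) (k w : ℕ) (o : Fin n) (σ : ℕ → Fin n) :
    Prop where
  stable : SubstStable K
  low : ∀ l, 1 ≤ l → l < k → ContainsDegree K l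
  ne : ∀ q ≤ w, σ q ≠ o
  inj : ∀ p ≤ w, ∀ q ≤ w, σ p = σ q → p = q

namespace SlotSetup

variable {k w : ℕ} {o : Fin n} {σ : ℕ → Fin n}

theorem swap (S : SlotSetup K k w o σ) {A B : List (Fin n)} {i j : Fin n} (hi : i ≠ o)
    (hj : j ≠ o) (hl : (A ++ i :: j :: B).length = k) (hc : (A ++ i :: j :: B).count o = w) :
    wordClass K o (A ++ i :: j :: B) = wordClass K o (A ++ j :: i :: B) := by
  have h := derSingle_commutator_mem S.low S.ne S.inj [i] j A B (by simpa using hi.symm) hj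
    (by simp) (by simp at hl ⊢; omega) (by simpa [hi, hj] using hc)
  rw [adWord_cons, adWord_nil, bracket_bracket, map_sub, derSingle_sub, ← modClass_eq_zero,
    map_sub, sub_eq_zero] at h
  simpa [wordClass, adWord_append] using h

theorem perm (S : SlotSetup K k w o σ) {A B u v : List (Fin n)} (huv : u.Perm v) (hu : o ∉ u)
    (hl : (A ++ (u ++ B)).length = k) (hc : (A ++ (u ++ B)).count o = w) :
    wordClass K o (A ++ (u ++ B)) = wordClass K o (A ++ (v ++ B)) := by
  induction huv generalizing A with
  | nil => rfl
  | cons x h ih =>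
    simp only [List.mem_cons, not_or] at hu
    have := ih (A := A ++ [x]) hu.2 (by simpa using hl) (by simpa using hc)
    simpa using this
  | swap x y l =>
    simp only [List.mem_cons, not_or] at hu
    exact S.swap (Ne.symm hu.1) (Ne.symm hu.2.1) hl hc
  | trans h1 h2 ih1 ih2 =>
    rw [ih1 hu hl hc]
    refine ih2 (fun h => hu (h1.mem_iff.2 h)) ?_ ?_
    · rw [← hl]; simp [h1.length_eq]
    · rw [← hc]; simp [h1.count_eq]

theorem eq_zero_of_diag (S : SlotSetup K k w o σ) {b : List (Fin n)} (hl : b.length = k)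
    (hc : b.count o = w)
    (hdiag : ∀ b', slotPattern o b' = slotPattern o b → offSlot o σ 0 b' = 0 →
      wordClass K o b' = 0) : wordClass K o b = 0 := by
  have hτ : (slotPattern o b).count true = w := by rw [slotPattern_count, hc]
  have hlen : ∀ b', slotPattern o b' = slotPattern o b → b'.length = k ∧ b'.count o = w := by
    intro b' h
    exact ⟨by rw [← slotPattern_length (o := o), h, slotPattern_length, hl],
      by rw [← slotPattern_count, h, hτ]⟩
  refine eq_zero_of_offSlot_eq_zero hτ S.ne S.inj ?_ ?_ hdiag rfl
  · intro A i j B hi hj hp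
    exact S.swap hi hj (hlen _ hp).1 (hlen _ hp).2
  · intro b' _ hb' i j hi hj hij
    exact splitSum_wordClass_eq_zero S.stable hi hj hij hb'

end SlotSetup

/-! ### Vanishing of the classes of words of positive weight -/

theorem lie_adWord_pair (i o : Fin n) (z : FreeNil n d) :
    ⁅adWord [i, i] (gen n d o), z⁆ =
      adWord [i, i, o] z - (2 : ℝ) • adWord [i, o, i] z + adWord [o, i, i] z := by
  have h : ∀ (L : Type) [LieRing L] [LieAlgebra ℝ L] (a b z : L),
      ⁅⁅a, ⁅a, b⁆⁆, z⁆ = ⁅a, ⁅a, ⁅b, z⁆⁆⁆ - (2 : ℝ) • ⁅a, ⁅b, ⁅a, z⁆⁆⁆ + ⁅b, ⁅a, ⁅a, z⁆⁆⁆ := by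
    intro L _ _ a b z
    simp only [lie_lie, lie_sub, two_smul]
    abel
  exact h (FreeNil n d) (gen n d i) (gen n d o) z

theorem wordClass_append_self {o : Fin n} (A : List (Fin n)) : wordClass K o (A ++ [o]) = 0 := by
  rw [wordClass, adWord_append, adWord_cons, adWord_nil, bracket_self, map_zero, derSingle_zero,
    map_zero]

theorem exists_of_slotPattern_eq {o : Fin n} {b A B : List (Fin n)}
    (h : slotPattern o b = slotPattern o (A ++ o :: B)) : ∃ A' B', b = A' ++ o :: B' ∧
      slotPattern o A' = slotPattern o A ∧ slotPattern o B' = slotPattern o B := by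
  rw [slotPattern_append, slotPattern] at h
  obtain ⟨A', C, rfl, hA, hC⟩ := List.map_eq_append_iff.1 h
  obtain ⟨x, B', rfl, hx, hB⟩ := List.map_eq_cons_iff.1 hC
  have hx : x = o := by simpa using hx
  exact ⟨A', B', by rw [hx], hA, hB⟩

namespace SlotSetup

variable {k w : ℕ} {o : Fin n} {σ : ℕ → Fin n}

/-- The bracket of x_o ↦ [x_i,[x_i,x_o]] with x_o ↦ b x_o, both of lower degree, expanded by the
Leibniz rule. -/
theorem quadratic_relation (S : SlotSetup K k w o σ) {i : Fin n} (hi : i ≠ o) {b : List (Fin n)}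
    (hb : 1 ≤ b.length) (hbk : b.length + 2 = k) :
    wordClass K o (b ++ [i, i]) - wordClass K o ([i, i] ++ b) +
      splitSum o (fun A B => wordClass K o (A ++ i :: i :: o :: B) -
        (2 : ℝ) • wordClass K o (A ++ i :: o :: i :: B) +
        wordClass K o (A ++ o :: i :: i :: B)) b = 0 := by
  have h : ⁅derSingle o (adWord [i, i] (gen n d o)), derSingle o (adWord b (gen n d o))⁆ ∈ K :=
    K.lie_mem (S.low 2 (by omega) (by omega) _ _ _ rfl) (S.low _ hb (by omega) _ _ _ rfl)
  rw [lie_derSingle_derSingle, derSingle_adWord_of_notMem (i := o) _ (u := [i, i])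
    (by simpa using hi.symm), derSingle_gen_self, derSingle_adWord, derSingle_gen_self,
    derSingle_add, ← modClass_eq_zero, map_sub, map_add, modClass_derSingle_splitSum] at h
  rw [← h, add_sub_right_comm]
  congr 1
  · rw [wordClass, wordClass, adWord_append, adWord_append]
  · refine splitSum_congr o fun A B _ => ?_
    rw [lie_adWord_pair, map_add, map_sub, map_smul, derSingle_add, derSingle_sub,
      ← derSingleLin_apply o ((2 : ℝ) • _), map_smul, map_add, map_sub, map_smul]
    simp only [wordClass, derSingleLin_apply, adWord_append, adWord_cons, adWord_nil]

/-- The class of a word of positive weight vanishes, provided that it vanishes when the last slot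
consists of its preferred letter. -/
theorem eq_zero_of_last (S : SlotSetup K k w o σ)
    (hone : ∀ A : List (Fin n), A.length + 2 = k → A.count o + 1 = w → offSlot o σ 0 A = 0 →
      wordClass K o (A ++ [o, σ w]) = 0)
    {A B : List (Fin n)} (hB : o ∉ B) (hk : A.length + 1 + B.length = k)
    (hw : A.count o + 1 = w) : wordClass K o (A ++ o :: B) = 0 := by
  induction ha : B.length using Nat.strong_induction_on generalizing A B with
  | _ a ih =>
  have hB0 : B.count o = 0 := List.count_eq_zero.2 hB
  refine S.eq_zero_of_diag (by simp; omega) (by simp [hB0, hw]) fun b hb hoff => ?_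
  obtain ⟨A', B', rfl, hA', hB'⟩ := exists_of_slotPattern_eq hb
  have hlA : A'.length = A.length := by simpa [slotPattern_length] using congrArg List.length hA'
  have hlB : B'.length = B.length := by simpa [slotPattern_length] using congrArg List.length hB'
  have hcA : A'.count o = A.count o := by
    simpa [slotPattern_count] using congrArg (List.count true) hA'
  have hcB : B'.count o = 0 := by
    simpa [slotPattern_count, hB0] using congrArg (List.count true) hB'
  have hoB' : o ∉ B' := List.count_eq_zero.1 hcB
  rw [offSlot_append, zero_add, hcA, offSlot, if_pos rfl, hw] at hoff
  have hBr : B' = List.replicate a (σ w) := by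
    rw [List.eq_replicate_iff]
    refine ⟨by omega, fun x hx => ?_⟩
    obtain ⟨p, hp1, hp2, rfl⟩ := eq_of_offSlot_eq_zero (o := o) (σ := σ) (q := w) (by omega) hx
      (fun h => hoB' (h ▸ hx))
    rw [show p = w by omega]
  have hio : σ w ≠ o := S.ne w le_rfl
  subst hBr
  match a, ha with
  | 0, _ => exact wordClass_append_self A'
  | 1, _ => exact hone A' (by omega) (by omega) (by omega)
  | a + 2, ha =>
    have hrep : ∀ r, o ∉ List.replicate r (σ w) := fun r h =>
      hio (List.eq_of_mem_replicate h).symm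
    -- The wanted word occurs twice with coefficient 1: from appending two letters to `b`, and from
    -- the last o of `b`. All other terms have a shorter last slot.
    have q := S.quadratic_relation hio (b := A' ++ o :: List.replicate a (σ w))
      (by simp; omega) (by simp; omega)
    rw [splitSum_append, splitSum, if_pos rfl, splitSum_of_notMem o _ (hrep a), add_zero,
      splitSum_eq_zero, zero_add] at q
    · have e1 : wordClass K o ([σ w, σ w] ++ (A' ++ o :: List.replicate a (σ w))) = 0 := by
        have := ih a (by omega) (A := σ w :: σ w :: A') (hrep a) (by simp; omega)
          (by simp [hio]; omega) (by simp)
        simpa using this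
      have e2 : wordClass K o (A' ++ [] ++ σ w :: σ w :: o :: List.replicate a (σ w)) = 0 := by
        have := ih a (by omega) (A := A' ++ [σ w, σ w]) (hrep a) (by simp; omega)
          (by simp [hio]; omega) (by simp)
        simpa using this
      have e3 : wordClass K o (A' ++ [] ++ σ w :: o :: σ w :: List.replicate a (σ w)) = 0 := by
        have := ih (a + 1) (by omega) (A := A' ++ [σ w]) (hrep (a + 1)) (by simp; omega)
          (by simp [hio]; omega) (by simp)
        simpa [List.replicate_succ] using this
      have e4 : A' ++ o :: List.replicate a (σ w) ++ [σ w, σ w] =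
          A' ++ o :: List.replicate (a + 2) (σ w) := by
        rw [List.append_assoc, List.cons_append, List.replicate_add]; rfl
      have e5 : A' ++ [] ++ o :: σ w :: σ w :: List.replicate a (σ w) =
          A' ++ o :: List.replicate (a + 2) (σ w) := by
        simp [List.replicate_succ]
      rw [e1, e2, e3, e4, e5, sub_zero, smul_zero, sub_zero, zero_add, ← two_smul ℝ] at q
      exact (smul_eq_zero.1 q).resolve_left two_ne_zero
    · intro A1 A2 hA12
      rw [hA12] at hlA hcA
      simp only [List.length_append, List.length_cons] at hlA
      simp only [List.count_append, List.count_cons_self] at hcA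
      have f : ∀ C : List (Fin n), C.length = 3 → C.count o = 1 →
          wordClass K o (A1 ++ (C ++ (A2 ++ o :: List.replicate a (σ w)))) = 0 := by
        intro C hC1 hC2
        have := ih a (by omega) (A := A1 ++ (C ++ A2)) (hrep a) (by simp; omega)
          (by simp; omega) (by simp)
        simpa using this
      have f1 := f [σ w, σ w, o] rfl (by simp [hio])
      have f2 := f [σ w, o, σ w] rfl (by simp [hio])
      have f3 := f [o, σ w, σ w] rfl (by simp [hio])
      simp only [List.cons_append, List.nil_append] at f1 f2 f3
      rw [f1, f2, f3, smul_zero, sub_zero, zero_add]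

/-- The preferred letter of the last slot does not occur in `A`, so it occurs once in the word;
since it is not the moved letter, the index at it is 2. -/
theorem eq_zero_of_containsIndex_two (S : SlotSetup K k w o σ)
    (hidx : ContainsIndex K k 2 (σ w)) {A : List (Fin n)} (hk : A.length + 2 = k)
    (hA : A.count o + 1 = w) (hoff : offSlot o σ 0 A = 0) :
    wordClass K o (A ++ [o, σ w]) = 0 := by
  have hio : σ w ≠ o := S.ne w le_rfl
  have hnot : σ w ∉ A := fun h => by
    obtain ⟨p, -, hp, hpw⟩ := eq_of_offSlot_eq_zero hoff h hio
    have := S.inj w le_rfl p (by omega) hpw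
    omega
  refine wordClass_eq_zero.2 (hidx o o _ (by simpa using hk) ?_)
  simp [List.count_eq_zero.2 hnot, hio.symm]

/-- The bracket of x_i ↦ c x_o with x_o ↦ b x_o is, up to sign, x_i ↦ c b x_o. Changing the moved
generator to x_o, modulo index 1, replaces each i in turn by o. -/
theorem substitution_relation (S : SlotSetup K k w o σ) (hidx : ContainsIndex K k 1 o) {i : Fin n}
    (hi : i ≠ o) {c b : List (Fin n)} (hc : o ∉ c) (hb : o ∉ b) (hib : i ∉ b)
    (hc1 : 1 ≤ c.length) (hb1 : 1 ≤ b.length) (hk : c.length + b.length = k) :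
    splitSum i (fun A B => wordClass K o (A ++ o :: B)) (c ++ b) = 0 := by
  have h : ⁅derSingle i (adWord c (gen n d o)), derSingle o (adWord b (gen n d o))⁆ ∈ K :=
    K.lie_mem (S.low _ hc1 (by omega) _ _ _ rfl) (S.low _ hb1 (by omega) _ _ _ rfl)
  rw [lie_derSingle_derSingle, derSingle_adWord_gen_of_notMem _ hib hi.symm, derSingle_zero,
    zero_sub, derSingle_adWord_of_notMem _ hc, derSingle_gen_self, ← adWord_append,
    ← modClass_eq_zero, map_neg, neg_eq_zero,
    modClass_derSingle_eq S.stable hidx hi (by simpa using hk)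
      (by simp [List.count_eq_zero.2 hc, List.count_eq_zero.2 hb]),
    derSingle_adWord_gen_of_ne _ _ hi.symm, modClass_derSingle_splitSum] at h
  rw [← h]
  exact splitSum_congr i fun A B _ => by rw [wordClass, adWord_append, adWord_cons]

/-- With a single o, commuting letters within the two slots makes the terms A x x o B of the
quadratic relation cancel; twice the claimed difference is left. -/
theorem move_square (S : SlotSetup K k 1 o σ) {x : Fin n} (hx : x ≠ o) {A B : List (Fin n)}
    (hA : o ∉ A) (hB : o ∉ B) (hk : A.length + B.length + 3 = k) :
    wordClass K o (A ++ o :: x :: x :: B) = wordClass K o (A ++ x :: o :: x :: B) := by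
  have hA0 := List.count_eq_zero.2 hA
  have hB0 := List.count_eq_zero.2 hB
  have q := S.quadratic_relation hx (b := A ++ o :: B) (by simp; omega) (by simp; omega)
  rw [splitSum_append, splitSum, if_pos rfl, splitSum_of_notMem o _ hB,
    splitSum_of_notMem o _ hA, add_zero, zero_add] at q
  have e1 : wordClass K o (A ++ o :: B ++ [x, x]) = wordClass K o (A ++ o :: x :: x :: B) := by
    have := S.perm (A := A ++ [o]) (u := B ++ [x, x]) (v := [x, x] ++ B) (B := [])
      List.perm_append_comm (by simp [hB, hx.symm]) (by simp; omega) (by simp [hA0, hB0, hx])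
    simpa using this
  have e2 : wordClass K o ([x, x] ++ (A ++ o :: B)) = wordClass K o (A ++ x :: x :: o :: B) := by
    have := S.perm (A := []) (u := [x, x] ++ A) (v := A ++ [x, x]) (B := o :: B)
      List.perm_append_comm (by simp [hA, hx.symm]) (by simp; omega) (by simp [hA0, hB0, hx])
    simpa using this
  rw [e1, e2, List.append_nil] at q
  have q' : (2 : ℝ) • (wordClass K o (A ++ o :: x :: x :: B) -
      wordClass K o (A ++ x :: o :: x :: B)) = 0 := by
    rw [← q, smul_sub, two_smul]; abel
  exact sub_eq_zero.1 ((smul_eq_zero.1 q').resolve_left two_ne_zero)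

/-- For s = t + 1 put a = x^{t+1} o y, b = x^t y o x, c = x^t o x y. The relations (t+1)c + a = 0,
(t+1)b + a = 0 and t b + 2c = 0 give b = c, then (t+2)c = 0, hence a = 0. -/
theorem eq_zero_of_eq_one (S : SlotSetup K k 1 o σ) (hidx : ContainsIndex K k 1 o)
    {x y : Fin n} (hx : x ≠ o) (hy : y ≠ o) (hxy : x ≠ y) (s : ℕ) (hs : s + 2 = k) :
    wordClass K o (List.replicate s x ++ [o, y]) = 0 := by
  have hxr : ∀ r, o ∉ List.replicate r x := fun r h => hx (List.eq_of_mem_replicate h).symm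
  have hyr : ∀ r, y ∉ List.replicate r x := fun r h => hxy (List.eq_of_mem_replicate h).symm
  have hsplit : ∀ {r : ℕ} {X Y : List (Fin n)}, List.replicate (r + 1) x = X ++ x :: Y →
      ∃ p q, X = List.replicate p x ∧ Y = List.replicate q x ∧ p + q = r := by
    intro r X Y h
    refine ⟨X.length, Y.length, ?_, ?_, ?_⟩
    · exact List.eq_replicate_iff.2 ⟨rfl, fun z hz =>
        List.eq_of_mem_replicate (n := r + 1) (by rw [h]; simp [hz])⟩
    · exact List.eq_replicate_iff.2 ⟨rfl, fun z hz =>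
        List.eq_of_mem_replicate (n := r + 1) (by rw [h]; simp [hz])⟩
    · have := congrArg List.length h
      simp at this; omega
  rcases s with _ | t
  · have h := S.substitution_relation hidx hx (c := [x]) (b := [y]) (by simpa using hx.symm)
      (by simpa using hy.symm) (by simpa using hxy) le_rfl le_rfl (by simp; omega)
    simpa [splitSum, hxy.symm] using h
  set a := wordClass K o (List.replicate (t + 1) x ++ [o, y]) with ha
  set b := wordClass K o (List.replicate t x ++ [y, o, x]) with hb
  set c := wordClass K o (List.replicate t x ++ [o, x, y]) with hc
  have hmove : ∀ q p, p + q = t → wordClass K o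
      (List.replicate p x ++ o :: (List.replicate q x ++ [x, y])) = c := by
    intro q
    induction q with
    | zero => intro p hp; rw [hc, ← hp]; rfl
    | succ q ih =>
      intro p hp
      rw [← ih (p + 1) (by omega)]
      have h1 : List.replicate (q + 1) x ++ [x, y] = x :: x :: (List.replicate q x ++ [y]) := by
        rw [List.replicate_succ', List.append_assoc]
        change List.replicate q x ++ ([x] ++ ([x] ++ [y])) = _
        rw [← List.append_assoc, ← List.replicate_succ', ← List.append_assoc,
          ← List.replicate_succ']
        rfl
      have h2 : List.replicate q x ++ [x, y] = x :: (List.replicate q x ++ [y]) := by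
        change List.replicate q x ++ ([x] ++ [y]) = _
        rw [← List.append_assoc, ← List.replicate_succ']
        rfl
      rw [h1, h2, S.move_square hx (hxr p) (by simp [hxr, hy.symm]) (by simp; omega),
        List.replicate_succ']
      simp
  have r1 : (t + 1) • c + a = 0 := by
    have h := S.substitution_relation hidx hx (c := List.replicate (t + 2) x) (b := [y])
      (hxr _) (by simpa using hy.symm) (by simpa using hxy) (by simp) le_rfl (by simp; omega)
    rw [List.replicate_succ', List.append_assoc, splitSum_append, splitSum_eq_smul x (m := c),
      List.count_replicate_self] at h
    · simpa [splitSum, hxy.symm] using h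
    · intro X Y hXY
      obtain ⟨p, q, rfl, rfl, hpq⟩ := hsplit hXY
      exact hmove q p hpq
  have hz1 : wordClass K o (List.replicate (t + 1) x ++ [o, x]) = 0 := by
    have h := S.substitution_relation hidx hy (c := List.replicate (t + 1) x ++ [y]) (b := [x])
      (by simp [hxr, hy.symm]) (by simpa using hx.symm) (by simpa using hxy.symm) (by simp)
      le_rfl (by simp; omega)
    rw [List.append_assoc, splitSum_append, splitSum_of_notMem y _ (hyr _)] at h
    simpa [splitSum, hxy] using h
  have hz2 : wordClass K o (List.replicate t x ++ [o, x, x]) = 0 := by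
    have h := S.substitution_relation hidx hy (c := List.replicate t x ++ [y]) (b := [x, x])
      (by simp [hxr, hy.symm]) (by simpa using hx.symm) (by simpa using hxy.symm) (by simp)
      (by simp) (by simp; omega)
    rw [List.append_assoc, splitSum_append, splitSum_of_notMem y _ (hyr _)] at h
    simpa [splitSum, hxy] using h
  have hperm : ∀ p q, p + q = t → wordClass K o
      (List.replicate p x ++ y :: (List.replicate q x ++ [o, x])) = b := by
    intro p q hpq
    have := S.perm (A := List.replicate p x) (u := y :: List.replicate q x)
      (v := List.replicate q x ++ [y]) (B := [o, x]) (List.perm_append_comm (l₁ := [y]))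
      (by simp [hxr, hy.symm]) (by simp; omega)
      (by simp [List.count_eq_zero.2 (hxr _), hy, hx])
    rw [List.cons_append] at this
    rw [this, hb, ← hpq, List.replicate_add]
    simp only [List.append_assoc, List.cons_append, List.nil_append]
  -- This and `r3` come from substituting y for x in the zero classes `hz1` and `hz2`.
  have r2 : (t + 1) • b + a = 0 := by
    have h := splitSum_wordClass_eq_zero S.stable hx hy hxy hz1
    rw [splitSum_append, splitSum_eq_smul x (m := b), List.count_replicate_self] at h
    · simpa [splitSum, hx.symm] using h
    · intro X Y hXY
      obtain ⟨p, q, rfl, rfl, hpq⟩ := hsplit hXY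
      exact hperm p q hpq
  have r3 : t • b + (2 : ℝ) • c = 0 := by
    have h := splitSum_wordClass_eq_zero S.stable hx hy hxy hz2
    rw [splitSum_append, splitSum_eq_smul x (m := b), List.count_replicate_self] at h
    · have e : wordClass K o (List.replicate t x ++ [o, y, x]) = c := by
        have := S.perm (A := List.replicate t x ++ [o]) (u := [y, x]) (v := [x, y]) (B := [])
          (List.Perm.swap _ _ _) (by simp [hx.symm, hy.symm]) (by simp; omega)
          (by simp [List.count_eq_zero.2 (hxr _), hy, hx])
        simpa using this
      rw [two_smul]
      simpa [splitSum, hx.symm, e] using h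
    · intro X Y hXY
      rcases t with _ | t
      · simp at hXY
      obtain ⟨p, q, rfl, rfl, hpq⟩ := hsplit hXY
      have := S.move_square hx (A := List.replicate p x ++ y :: List.replicate q x) (B := [])
        (by simp [hxr, hy.symm]) (by simp) (by simp; omega)
      rw [← hperm p (q + 1) (by omega)]
      simpa [List.replicate_succ'] using this
  simp only [← Nat.cast_smul_eq_nsmul ℝ] at r1 r2 r3
  have hbc : b = c := by
    have : ((t + 1 : ℕ) : ℝ) • (b - c) = 0 := by
      rw [smul_sub, sub_eq_zero]
      exact add_right_cancel (r2.trans r1.symm)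
    exact sub_eq_zero.1 ((smul_eq_zero.1 this).resolve_left (by positivity))
  rw [hbc, ← add_smul] at r3
  have hc0 : c = 0 := (smul_eq_zero.1 r3).resolve_left (by positivity)
  simpa [hc0] using r1

theorem eq_zero_of_pos (S : SlotSetup K k w o σ) (hw : 1 ≤ w)
    (hidx : ∀ v ≤ w, ∀ o, ContainsIndex K k v o) {h : List (Fin n)} (hl : h.length = k)
    (hc : h.count o = w) : wordClass K o h = 0 := by
  obtain ⟨B, A, hB, rfl⟩ : ∃ B A, o ∉ B ∧ h = A ++ o :: B := by
    have ho : o ∈ h.reverse := List.mem_reverse.2 (List.count_pos_iff.1 (by omega))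
    obtain ⟨C, D, hCD, hC⟩ := List.eq_append_cons_of_mem ho
    refine ⟨C.reverse, D.reverse, by simpa using hC, ?_⟩
    rw [← List.reverse_reverse h, hCD]
    simp
  have hB0 := List.count_eq_zero.2 hB
  refine S.eq_zero_of_last ?_ hB (by simp at hl; omega) (by simp [hB0] at hc; omega)
  intro A hA hAc hoff
  rcases Nat.lt_or_ge w 2 with hw2 | hw2
  · obtain rfl : w = 1 := by omega
    have hAr : A = List.replicate A.length (σ 0) := by
      refine List.eq_replicate_iff.2 ⟨rfl, fun x hx => ?_⟩
      have hoA : o ∉ A := List.count_eq_zero.1 (by omega)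
      obtain ⟨p, -, hp, rfl⟩ := eq_of_offSlot_eq_zero hoff hx (fun h => hoA (h ▸ hx))
      rw [show p = 0 by omega]
    rw [hAr]
    exact S.eq_zero_of_eq_one (hidx 1 le_rfl o) (S.ne 0 (by omega)) (S.ne 1 le_rfl)
      (fun h => absurd (S.inj 0 (by omega) 1 le_rfl h) (by omega)) _ hA
  · exact S.eq_zero_of_containsIndex_two (hidx 2 hw2 _) hA hAc hoff

end SlotSetup

/-! ### Derivations of weight `-1` -/

theorem bracket_derSingle_transport (hK : SubstStable K) {a b c : Fin n}
    (hab : a ≠ b) (hbc : b ≠ c)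
    (h : derSingle a (LieRing.toBracket.bracket (gen n d b) (gen n d c)) ∈ K) :
    derSingle a (LieRing.toBracket.bracket (gen n d c) (gen n d b)) ∈ K ∧
    derSingle b (LieRing.toBracket.bracket (gen n d a) (gen n d c)) ∈ K ∧
    (∀ e, e ≠ a → e ≠ b → e ≠ c →
      derSingle a (LieRing.toBracket.bracket (gen n d b) (gen n d e)) ∈ K) ∧
    (∀ e, e ≠ a → e ≠ b → e ≠ c →
      derSingle e (LieRing.toBracket.bracket (gen n d b) (gen n d c)) ∈ K) := by
  refine ⟨?_, ?_, ?_, ?_⟩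
  · rw [bracket_skew, derSingle_neg]
    exact neg_mem h
  · have e1 : ⁅derSingle b (gen n d a),
          derSingle a (LieRing.toBracket.bracket (gen n d b) (gen n d c))⁆ =
        derSingle a (LieRing.toBracket.bracket (gen n d a) (gen n d c)) -
          derSingle b (LieRing.toBracket.bracket (gen n d b) (gen n d c)) := by
      rw [lie_derSingle_derSingle, derivation_lie, derSingle_gen_self, derSingle_gen_self,
        derSingle_gen_of_ne hbc.symm, bracket_zero, add_zero]
    have e2 : ⁅derSingle b (gen n d a),
          derSingle a (LieRing.toBracket.bracket (gen n d a) (gen n d c))⁆ =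
        -derSingle b (LieRing.toBracket.bracket (gen n d a) (gen n d c)) := by
      rw [lie_derSingle_derSingle, derivation_lie, derSingle_gen_self, derSingle_gen_of_ne hab,
        derSingle_gen_of_ne hbc.symm, bracket_zero, zero_lie, add_zero, derSingle_zero, zero_sub]
    have e3 : ⁅derSingle b (gen n d a),
          derSingle b (LieRing.toBracket.bracket (gen n d b) (gen n d c))⁆ =
        derSingle b (LieRing.toBracket.bracket (gen n d a) (gen n d c)) := by
      rw [lie_derSingle_derSingle, derivation_lie, derSingle_gen_self,
        derSingle_gen_of_ne hbc.symm, derSingle_gen_of_ne hab, bracket_zero, add_zero,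
        derSingle_zero, sub_zero]
    -- Applying x_b ↦ x_a twice exchanges the roles of a and b, with factor -2.
    have h2 := hK b a hab.symm _ (hK b a hab.symm _ h)
    rw [e1, lie_sub, e2, e3, ← neg_add', ← two_smul ℝ] at h2
    have h3 := K.smul_mem (2⁻¹ : ℝ) (neg_mem_iff.1 h2)
    rwa [smul_smul, inv_mul_cancel₀ two_ne_zero, one_smul] at h3
  · intro e hea heb hec
    have h2 := hK c e hec.symm _ h
    rw [lie_derSingle_derSingle, derivation_lie, derSingle_gen_self, derSingle_gen_of_ne hbc,
      derSingle_gen_of_ne hea, zero_lie, zero_add, derSingle_zero, sub_zero] at h2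
    exact h2
  · intro e hea heb hec
    have h2 := hK e a hea _ h
    rw [lie_derSingle_derSingle, derivation_lie, derSingle_gen_self, derSingle_gen_of_ne heb.symm,
      derSingle_gen_of_ne hec.symm, zero_lie, bracket_zero, zero_add, derSingle_zero,
      zero_sub] at h2
    exact neg_mem_iff.1 h2

theorem derSingle_bracket_mem (hK : SubstStable K) {a₀ b₀ c₀ : Fin n}
    (hab : a₀ ≠ b₀) (hac : a₀ ≠ c₀) (hbc : b₀ ≠ c₀)
    (h : derSingle a₀ (LieRing.toBracket.bracket (gen n d b₀) (gen n d c₀)) ∈ K)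
    {a b c : Fin n} (hab' : a ≠ b) (hac' : a ≠ c) (hbc' : b ≠ c) :
    derSingle a (LieRing.toBracket.bracket (gen n d b) (gen n d c)) ∈ K := by
  obtain ⟨b₁, c₁, h1, h2, h3, h⟩ : ∃ b₁ c₁, a ≠ b₁ ∧ a ≠ c₁ ∧ b₁ ≠ c₁ ∧
      derSingle a (LieRing.toBracket.bracket (gen n d b₁) (gen n d c₁)) ∈ K := by
    by_cases ha : a = a₀
    · exact ⟨b₀, c₀, ha ▸ hab, ha ▸ hac, hbc, ha ▸ h⟩
    by_cases hb : a = b₀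
    · exact ⟨a₀, c₀, ha, hb ▸ hbc, hac,
        hb ▸ (bracket_derSingle_transport hK hab hbc h).2.1⟩
    by_cases hc : a = c₀
    · exact ⟨a₀, b₀, ha, hb, hab, hc ▸ (bracket_derSingle_transport hK hac hbc.symm
        (bracket_derSingle_transport hK hab hbc h).1).2.1⟩
    · exact ⟨b₀, c₀, hb, hc, hbc,
        (bracket_derSingle_transport hK hab hbc h).2.2.2 a ha hb hc⟩
  obtain ⟨c₂, h4, h5, h⟩ : ∃ c₂, a ≠ c₂ ∧ b ≠ c₂ ∧
      derSingle a (LieRing.toBracket.bracket (gen n d b) (gen n d c₂)) ∈ K := by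
    by_cases hb : b = b₁
    · exact ⟨c₁, h2, hb ▸ h3, hb ▸ h⟩
    have h' := (bracket_derSingle_transport hK h1 h3 h).1
    by_cases hc : b = c₁
    · exact ⟨b₁, h1, hb, hc ▸ h'⟩
    · refine ⟨b₁, h1, hb, ?_⟩
      have h'' := (bracket_derSingle_transport hK h1 h3 h).2.2.1 b hab'.symm hb hc
      exact (bracket_derSingle_transport hK h1 (Ne.symm hb) h'').1
  by_cases hc : c = c₂
  · exact hc ▸ h
  · exact (bracket_derSingle_transport hK hab' h5 h).2.2.1 c hac'.symm hbc'.symm hc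

theorem containsIndex_zero {k : ℕ} (hlow : ∀ l, 1 ≤ l → l < k → ContainsDegree K l)
    (htri : ∀ a b c : Fin n, a ≠ b → a ≠ c → b ≠ c →
      derSingle a (LieRing.toBracket.bracket (gen n d b) (gen n d c)) ∈ K)
    (hk : 1 ≤ k) (o : Fin n) : ContainsIndex K k 0 o := by
  intro i j u hu hc
  obtain rfl : i = o := by by_contra h; simp [h] at hc
  have hnot : i ∉ u ++ [j] := List.count_eq_zero.1 (by omega)
  rcases u with _ | ⟨l, u⟩
  · simp at hu; omega
  simp only [List.cons_append, List.mem_cons, List.mem_append, List.not_mem_nil, or_false,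
    not_or] at hnot
  obtain ⟨hl, hiu, hj⟩ := hnot
  rcases u with _ | ⟨m, u⟩
  · rcases eq_or_ne l j with rfl | hlj
    · rw [adWord_cons, adWord_nil, bracket_self, derSingle_zero]
      exact zero_mem _
    · exact htri i l j hl hj hlj
  · simp only [List.length_cons] at hu
    -- For k ≥ 2, bracketing with x_i ↦ [x_l, x_i] prefixes the letter l, up to sign.
    have h := K.lie_mem (hlow 1 le_rfl (by omega) i i [l] rfl)
      (hlow (u.length + 1) (by omega) (by omega) i j (m :: u) rfl)
    rw [lie_derSingle_derSingle, derSingle_adWord_gen_of_notMem _ hiu (Ne.symm hj),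
      derSingle_zero, zero_sub, derSingle_adWord_of_notMem (i := i) _ (u := [l])
        (by simpa using hl), derSingle_gen_self, ← adWord_append] at h
    exact neg_mem_iff.1 h

/-! ### Derivations of weight `0` -/

theorem AD_eq_sum (i : Fin n) (k : ℕ) : AD d (FreeAlgebra.ι ℝ i ^ k) =
    ∑ j, derSingle j (adWord (List.replicate k i) (gen n d j)) := by
  rw [derivation_eq_sum (AD d _)]
  refine Finset.sum_congr rfl fun j _ => ?_
  rw [AD, derOfGens_gen, adSubst_pow]

theorem adWord_replicate_gen {k : ℕ} (hk : 1 ≤ k) (i : Fin n) :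
    adWord (List.replicate k i) (gen n d i) = 0 := by
  obtain ⟨k, rfl⟩ : ∃ l, k = l + 1 := ⟨k - 1, by omega⟩
  rw [List.replicate_succ', adWord_append, adWord_cons, adWord_nil, bracket_self, map_zero]

theorem wordClass_replicate_of_AD (hK : SubstStable K) {k : ℕ} (hk : 1 ≤ k) {i o : Fin n}
    (hio : i ≠ o) (hidx : ContainsIndex K k 0 o) (hAD : AD d (FreeAlgebra.ι ℝ i ^ k) ∈ K) :
    wordClass K o (List.replicate k i) = 0 := by
  have hnot : ∀ j, j ≠ i → j ∉ List.replicate k i := fun j hj h =>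
    hj (List.eq_of_mem_replicate h)
  rw [AD_eq_sum, ← modClass_eq_zero, map_sum,
    ← Finset.sum_erase (a := i) _ (by rw [adWord_replicate_gen hk, derSingle_zero, map_zero]),
    Finset.sum_congr rfl (g := fun _ => wordClass K o (List.replicate k i)), Finset.sum_const,
    ← Nat.cast_smul_eq_nsmul ℝ] at hAD
  · refine (smul_eq_zero.1 hAD).resolve_left (Nat.cast_ne_zero.2 ?_)
    exact (Finset.card_pos.2 ⟨o, by simp [hio.symm]⟩).ne'
  · intro j hj
    have hji : j ≠ i := (Finset.mem_erase.1 hj).1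
    rcases eq_or_ne j o with rfl | hjo
    · rfl
    · rw [modClass_derSingle_eq hK hidx hjo (by simp)
        (by simp [List.count_eq_zero.2 (hnot o hio.symm), hjo]),
        derSingle_adWord_of_notMem _ (hnot j hji), derSingle_gen_self]
      rfl

theorem containsIndex_one (hK : SubstStable K) {k : ℕ}
    (hlow : ∀ l, 1 ≤ l → l < k → ContainsDegree K l) {i o : Fin n} (hio : i ≠ o)
    (hidx : ContainsIndex K k 0 o) (hi : wordClass K o (List.replicate k i) = 0) :
    ContainsIndex K k 1 o := by
  refine containsIndex_succ hK hidx fun h hl hc => ?_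
  have S : SlotSetup K k 0 o (fun _ => i) := ⟨hK, hlow, fun _ _ => hio, fun p hp q hq _ => by omega⟩
  refine S.eq_zero_of_diag hl hc fun b hb hoff => ?_
  have hbl : b.length = k := by rw [← slotPattern_length (o := o), hb, slotPattern_length, hl]
  have hbc : b.count o = 0 := by rw [← slotPattern_count, hb, slotPattern_count, hc]
  have hob : o ∉ b := List.count_eq_zero.1 hbc
  rw [show b = List.replicate k i from List.eq_replicate_iff.2 ⟨hbl, fun x hx => ?_⟩]
  · exact hi
  · obtain ⟨p, -, -, h⟩ := eq_of_offSlot_eq_zero hoff hx (fun h => hob (h ▸ hx))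
    exact h

/-- The w + 1 slots need as many distinct letters among the n - 1 letters other than `o`; this
limits the index to n - 1. -/
theorem exists_slot_letters {w : ℕ} (hw : w + 2 ≤ n) (o : Fin n) : ∃ σ : ℕ → Fin n,
    (∀ q ≤ w, σ q ≠ o) ∧ ∀ p ≤ w, ∀ q ≤ w, σ p = σ q → p = q := by
  obtain ⟨m, rfl⟩ : ∃ m, n = m + 1 := ⟨n - 1, by omega⟩
  have hm : w < m := by omega
  refine ⟨fun q => o.succAbove (if h : q < m then ⟨q, h⟩ else ⟨0, by omega⟩), fun q _ =>
    Fin.succAbove_ne _ _, fun p hp q hq h => ?_⟩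
  have h := Fin.succAbove_right_injective h
  rw [dif_pos (by omega), dif_pos (by omega)] at h
  exact Fin.mk.inj_iff.1 h

/-! ### All derivations -/

theorem containsDegree_of_generators (hK : SubstStable K) {k : ℕ} (hk : 1 ≤ k)
    (hkn : k < n * (n - 1)) (hlow : ∀ l, 1 ≤ l → l < k → ContainsDegree K l)
    (htri : ∀ a b c : Fin n, a ≠ b → a ≠ c → b ≠ c →
      derSingle a (LieRing.toBracket.bracket (gen n d b) (gen n d c)) ∈ K)
    (z : Fin n) (hAD : AD d (FreeAlgebra.ι ℝ z ^ k) ∈ K) : ContainsDegree K k := by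
  have hn : 2 ≤ n := by
    by_contra h
    interval_cases n <;> simp at hkn
  have h0 := containsIndex_zero hlow htri hk
  have h1' : ∀ o, o ≠ z → ContainsIndex K k 1 o := fun o ho =>
    containsIndex_one hK hlow ho.symm (h0 o) (wordClass_replicate_of_AD hK hk ho.symm (h0 o) hAD)
  have h1 : ∀ o, ContainsIndex K k 1 o := by
    intro o
    by_cases ho : o = z
    · subst ho
      obtain ⟨σ, hσ, hinj⟩ := exists_slot_letters (w := 0) hn o
      refine containsIndex_one hK hlow (hσ 0 le_rfl) (h0 o) ?_
      rw [wordClass_eq_zero]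
      -- The generator AD says nothing directly about o = z. For n = 2 the bound forces k = 1, and a
      -- substitution suffices. For n ≥ 3 the word σ(0)^k avoids a third letter p, so its derivation
      -- has index 1 at p, a case already known.
      rcases Nat.lt_or_ge n 3 with hn3 | hn3
      · obtain rfl : n = 2 := by omega
        obtain rfl : k = 1 := by omega
        have h := hK o (σ 0) (hσ 0 le_rfl).symm _
          (h1' (σ 0) (hσ 0 le_rfl) (σ 0) (σ 0) [o] rfl (by simp [(hσ 0 le_rfl).symm]))
        rw [lie_derSingle_derSingle, adWord_cons, adWord_nil, derivation_lie, derSingle_gen_self,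
          derSingle_gen_of_ne (hσ 0 le_rfl), bracket_self, bracket_zero, zero_add, derSingle_zero,
          zero_sub, derSingle_gen_self, ← derSingle_neg, ← bracket_skew] at h
        exact h
      · obtain ⟨σ', hσ', hinj'⟩ := exists_slot_letters (w := 1) hn3 o
        obtain ⟨p, hp, hpne⟩ : ∃ p, p ≠ o ∧ p ≠ σ 0 := by
          by_cases h : σ' 0 = σ 0
          · refine ⟨σ' 1, hσ' 1 le_rfl, fun h' => ?_⟩
            exact absurd (hinj' 0 (by omega) 1 le_rfl (h.trans h'.symm)) (by omega)
          · exact ⟨σ' 0, hσ' 0 (by omega), h⟩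
        refine h1' p hp o o _ (by simp) ?_
        have : (List.replicate k (σ 0)).count p = 0 :=
          List.count_eq_zero.2 fun h => hpne (List.eq_of_mem_replicate h)
        simp [this, hp.symm]
    · exact h1' o ho
  have hall : ∀ v, v + 1 ≤ n → ∀ o, ContainsIndex K k v o := by
    intro v
    induction v using Nat.strong_induction_on with
    | _ v ih =>
      intro hv o
      match v, ih, hv with
      | 0, _, _ => exact h0 o
      | 1, _, _ => exact h1 o
      | w + 2, ih, hv =>
        obtain ⟨σ, hσ, hinj⟩ := exists_slot_letters (w := w + 1) (by omega) o
        have S : SlotSetup K k (w + 1) o σ := ⟨hK, hlow, hσ, hinj⟩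
        exact containsIndex_succ hK (ih (w + 1) (by omega) (by omega) o) fun h hl hc =>
          S.eq_zero_of_pos (by omega) (fun v hv => ih v (by omega) (by omega)) hl hc
  intro i j u hu
  by_contra hcon
  -- A derivation outside `K` has index at least n at every letter. Summing gives n² ≤ k + n,
  -- against k < n(n-1).
  have hge : ∀ o : Fin n, n ≤ (u ++ [j]).count o + (if i = o then 0 else 1) := by
    intro o
    by_contra hlt
    exact hcon (hall _ (by omega) o i j u hu rfl)
  have hsum := Finset.sum_le_sum (s := Finset.univ) fun o _ => hge o
  have hcount : ∑ o, (u ++ [j]).count o = k + 1 := by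
    have := Multiset.sum_count_eq_card (s := Finset.univ) (m := ((u ++ [j] : List (Fin n)) :
      Multiset (Fin n))) (by simp)
    simpa [hu] using this
  have hone : ∑ o : Fin n, (if i = o then 0 else 1) + 1 = n := by
    rw [Finset.sum_ite]
    simp [Finset.filter_ne]
    omega
  rw [Finset.sum_add_distrib, hcount, Finset.sum_const, Finset.card_univ, Fintype.card_fin,
    smul_eq_mul] at hsum
  obtain ⟨m, rfl⟩ : ∃ m, n = m + 1 := ⟨n - 1, by omega⟩
  simp only [Nat.add_sub_cancel] at hkn
  nlinarith

end FreeNilpotentLie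
end

/-! ### The generation theorem -/

theorem mainTheorem5 (n d : ℕ) (hd : d ≤ n * (n - 1)) :
    FreeNilpotentLie.lieSlSpan
      ({δ : FreeNilpotentLie.Der n d | ∃ (hn : 1 ≤ n) (k : ℕ), 1 ≤ k ∧ k < d ∧
          δ = FreeNilpotentLie.AD d (FreeAlgebra.ι ℝ (⟨0, hn⟩ : Fin n) ^ k)} ∪
        {δ : FreeNilpotentLie.Der n d | ∃ hn : 3 ≤ n,
          δ = FreeNilpotentLie.derSingle (⟨0, by omega⟩ : Fin n)
            ⁅FreeNilpotentLie.gen n d ⟨1, by omega⟩, FreeNilpotentLie.gen n d ⟨2, by omega⟩⁆}) =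
      FreeNilpotentLie.UL n d := by
  open FreeNilpotentLie in
  refine le_antisymm (sInf_le ⟨?_, fun A _ δ hδ => UL_sl_stable A hδ⟩) (le_sInf ?_)
  · rintro δ (⟨hn, k, hk, hkd, rfl⟩ | ⟨hn, rfl⟩)
    · refine derComponent_le_UL hk (derOfGens_mem_derComponent fun i => ?_)
      rw [adSubst_pow]
      have h := isMonomial_adWord (d := d) (List.replicate k ⟨0, hn⟩) i
      rw [List.length_replicate] at h
      exact Submodule.subset_span h
    · refine derComponent_le_UL le_rfl (derOfGens_mem_derComponent fun i => ?_)
      by_cases hi : i = ⟨0, by omega⟩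
      · subst hi
        rw [Pi.single_eq_same]
        exact Submodule.subset_span (.lie (.gen _) (.gen _))
      · rw [Pi.single_eq_of_ne hi]
        exact zero_mem _
  · rintro K ⟨hs, hsl⟩
    have hK : SubstStable K := fun i j hij δ hδ => lie_derSingle_mem_of_sl_stable hsl hij hδ
    have htri : ∀ a b c : Fin n, a ≠ b → a ≠ c → b ≠ c →
        derSingle a (LieRing.toBracket.bracket (gen n d b) (gen n d c)) ∈ K := by
      intro a b c hab hac hbc
      have hn : 3 ≤ n := by
        by_contra h
        have := a.2; have := b.2; have := c.2
        rw [Ne, Fin.ext_iff] at hab hac hbc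
        omega
      refine derSingle_bracket_mem hK (a₀ := ⟨0, by omega⟩) (b₀ := ⟨1, by omega⟩)
        (c₀ := ⟨2, by omega⟩) (by simp) (by simp) (by simp) (hs (Or.inr ⟨hn, rfl⟩)) hab hac hbc
    have hdeg : ∀ k, 1 ≤ k → k < d → ContainsDegree K k := by
      intro k
      induction k using Nat.strong_induction_on with
      | _ k ih =>
        intro hk hkd
        have hn : 1 ≤ n := by
          rcases n with _ | n
          · simp at hd; omega
          · omega
        exact containsDegree_of_generators hK hk (by omega)
          (fun l hl hlk => ih l hlk hl (by omega)) htri ⟨0, hn⟩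
          (hs (Or.inl ⟨hn, k, hk, hkd, rfl⟩))
    exact UL_le_of_derSingle_mem fun u hu hud i j => hdeg u.length hu hud i j u rfl
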